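/- Let $(R,\mathfrak m,k)$ be a (Noetherian) Cohen--Macaulay local ring of dimension $d$, and let $M$ be a finitely generated $R$-module of constant rank, i.e. for some $n\ge 0$ one has $M_{\mathfrak p}\cong R_{\mathfrak p}^{\,n}$ for all minimal primes $\mathfrak p$ of $R$. Write $M^*=\operatorname{Hom}_R(M,R)$ and suppose that $$\operatorname{Ext}^i_R(M,M)=0\quad\text{and}\quad \operatorname{Ext}^i_R(M^*,R)=0\qquad\text{for } 1\le i\le d.$$ A finitely generated module $N$ is called maximal Cohen--Macaulay (MCM) if $\operatorname{depth} N\ge d$ (so the zero module is MCM). A canonical module of $R$ is an MCM module $\omega$ of finite injective dimension with $\operatorname{Ext}^d_R(k,\omega)\cong k$. (1) Suppose that $M$ is reflexive, i.e. the natural map $M\to M^{**}$ is an isomorphism. If an ideal $\omega\subseteq R$ is a canonical module of $R$, then $\omega\otimes_R M^*\otimes_R M$ is MCM. (2) Suppose instead that $R$ is $\mathfrak m$-adically complete, that $R_{\mathfrak p}$ is a complete intersection (its completion is the quotient of a regular local ring by a regular sequence) for every prime $\mathfrak p$ of height at most one, that $R$ is Gorenstein or contains $\mathbb Q$, that $M$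 is MCM, and that also $\operatorname{Ext}^i_R(M,R)=0$ for $1\le i\le d$. Then for every canonical module $\omega$ of $R$ the module $\omega\otimes_R M^*\otimes_R M$ is MCM, and the homomorphism $$1\otimes\alpha:\ \omega\otimes_R M^*\otimes_R M\to\omega\otimes_R\operatorname{Hom}_R(M,M),\qquad \alpha(f\otimes x)(y)=f(y)\,x,$$ is injective. -/

import Mathlib

open CategoryTheory IsLocalRing
open scoped TensorProduct

universe u

/-- A finitely generated module `N` over a Noetherian local ring `(R, 𝔪)` is maximal
Cohen-Macaulay if `N = 0` (whose depth is `∞`) or if there is an `N`-regular sequence in `𝔪`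
of length `dim R`, that is, `depth N ≥ dim R`. -/
def IsMaximalCohenMacaulay (R : Type u) [CommRing R] [IsLocalRing R]
    (N : Type u) [AddCommGroup N] [Module R N] : Prop :=
  Module.Finite R N ∧
    (Nontrivial N → ∃ rs : List R, (∀ r ∈ rs, r ∈ maximalIdeal R) ∧
      RingTheory.Sequence.IsRegular N rs ∧ ((rs.length : ℕ) : WithBot ℕ∞) = ringKrullDim R)

/-- A Noetherian local ring is Cohen-Macaulay if `depth R = dim R`. -/
def IsCohenMacaulayLocal (R : Type u) [CommRing R] [IsLocalRing R] : Prop :=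
  IsMaximalCohenMacaulay R R

/-- `N` has finite injective dimension over `R`. -/
def HasFiniteInjectiveDimension (R : Type u) [CommRing R]
    (N : Type u) [AddCommGroup N] [Module R N] : Prop :=
  ∃ n : ℕ, HasInjectiveDimensionLE (ModuleCat.of R N) n

/-- A Noetherian local ring is Gorenstein if it has finite injective dimension over itself. -/
def IsGorensteinLocal (R : Type u) [CommRing R] : Prop :=
  HasFiniteInjectiveDimension R R

/-- A canonical module of a Cohen-Macaulay local ring `(R, 𝔪, k)` of dimension `d`: a maximal
Cohen-Macaulay module of finite injective dimension and of type one, i.e.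
`Ext^d(k, ω)` is one-dimensional over `k`. -/
structure IsCanonicalModule (R : Type u) [CommRing R] [IsLocalRing R]
    (ω : Type u) [AddCommGroup ω] [Module R ω] : Prop where
  isMaximalCohenMacaulay : IsMaximalCohenMacaulay R ω
  hasFiniteInjectiveDimension : HasFiniteInjectiveDimension R ω
  type_one : ∃ d : ℕ, ringKrullDim R = d ∧
    Nonempty (Abelian.Ext (ModuleCat.of R (ResidueField R)) (ModuleCat.of R ω) d
      ≃ₗ[R] ResidueField R)

/-- `M` is free of one and the same rank at all minimal primes of `R`. -/
def HasConstantRank (R : Type u) [CommRing R]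
    (M : Type u) [AddCommGroup M] [Module R M] : Prop :=
  ∃ n : ℕ, ∀ (p : Ideal R) [p.IsPrime], p ∈ minimalPrimes R →
    Nonempty (LocalizedModule p.primeCompl M ≃ₗ[Localization.AtPrime p]
      (Fin n → Localization.AtPrime p))

/-- A Noetherian local ring is a complete intersection if its completion at the maximal ideal is
the quotient of a regular local ring by a regular sequence. -/
def IsCompleteIntersectionLocal (A : Type u) [CommRing A] [IsLocalRing A] : Prop :=
  ∃ (Q : Type u) (_ : CommRing Q) (_ : IsRegularLocalRing Q) (rs : List Q),
    RingTheory.Sequence.IsRegular Q rs ∧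
      Nonempty ((Q ⧸ Ideal.ofList rs) ≃+* AdicCompletion (maximalIdeal A) A)

/-- `R` is a complete intersection in codimension one: every localization of `R` at a prime of
height at most one is a complete intersection. -/
def IsCompleteIntersectionInCodimOne (R : Type u) [CommRing R] : Prop :=
  ∀ (p : Ideal R) [p.IsPrime], p.height ≤ 1 →
    IsCompleteIntersectionLocal (Localization.AtPrime p)

/-- `Ext^i_R(M, N) = 0` for `1 ≤ i ≤ d`. -/
def ExtVanishesUpTo (R : Type u) [CommRing R] (d : ℕ)
    (M : Type u) [AddCommGroup M] [Module R M] (N : Type u) [AddCommGroup N] [Module R N] :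
    Prop :=
  ∀ i : ℕ, 1 ≤ i → i ≤ d →
    Subsingleton (Abelian.Ext (ModuleCat.of R M) (ModuleCat.of R N) i)

/-! Let ω be maximal Cohen-Macaulay of finite injective dimension. Then `Ext^i(X, ω) = 0` for all i
≥ 1 and all finite X of depth d, so duality into ω is exact on such modules and preserves depth d.
The central object is the natural map `M ⊗ Hom(N, ω) → Hom(Hom(M, N), ω)`, an isomorphism for M
finite free. If N has depth d and `Ext^i(M, N) = 0` for 1 ≤ i ≤ d, then a free presentation of M
remains exact under `Hom(-, N)` and the modules of restricted maps that arise have depth d.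
Dualizing into ω is therefore exact on them, and comparison with the free case makes the map
bijective for M (`tensorHomToHomHom_bijective`).

For reflexive M, the pair `(M*, R)` gives `M* ⊗ ω ≅ Hom(M**, ω) ≅ Hom(M, ω)`, and the pair `(M, M)`
gives `M ⊗ Hom(M, ω) ≅ Hom(End M, ω)`. Since `End M` has depth d, so has its ω-dual; this is (1),
`depthGE_tensor_dual_tensor`.

For (2) it remains to prove that M is reflexive. The map `M → M**` is an isomorphism at the minimal
primes, and every functional on M extends to `M**`. An associated prime p of the cokernel cannot be
minimal, and depth excludes height at least two. In height one, a complete intersection modulo a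
nonzerodivisor x is Artinian with simple socle, hence self-injective; this yields a functional on
the smaller module that cannot extend (`IsCompleteIntersectionLocal.mem_of_forall_exists_comp_eq`).
Finally, the kernel of `1 ⊗ α` vanishes at the minimal primes and lies in a module of depth d, whose
associated primes are all minimal, so it is zero. -/

/-! ### Long exact sequences and vanishing of Ext -/

section ExtLemmas

variable {R : Type u} [CommRing R]

/-- `Ext^i_R(X, Y) = 0`. -/
abbrev ExtVanishes (R : Type u) [CommRing R] (X : Type u) [AddCommGroup X] [Module R X]
    (Y : Type u) [AddCommGroup Y] [Module R Y] (i : ℕ) : Prop :=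
  Subsingleton (Abelian.Ext (ModuleCat.of R X) (ModuleCat.of R Y) i)

variable {A B C X Y : Type u} [AddCommGroup A] [Module R A] [AddCommGroup B] [Module R B]
  [AddCommGroup C] [Module R C] [AddCommGroup X] [Module R X] [AddCommGroup Y] [Module R Y]

section ShortComplex

variable {S : ShortComplex (ModuleCat.{u} R)}

lemma subsingleton_ext_X₂_right (hS : S.ShortExact) {X : ModuleCat.{u} R} {i : ℕ}
    (h₁ : Subsingleton (Abelian.Ext X S.X₁ i)) (h₃ : Subsingleton (Abelian.Ext X S.X₃ i)) :
    Subsingleton (Abelian.Ext X S.X₂ i) := by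
  refine subsingleton_of_forall_eq 0 fun z => ?_
  obtain ⟨a, rfl⟩ := Abelian.Ext.covariant_sequence_exact₂ X hS z (h₃.elim _ _)
  rw [h₁.elim a 0, Abelian.Ext.zero_comp]

lemma subsingleton_ext_X₁_right (hS : S.ShortExact) {X : ModuleCat.{u} R} {i : ℕ}
    (h₃ : Subsingleton (Abelian.Ext X S.X₃ i)) (h₂ : Subsingleton (Abelian.Ext X S.X₂ (i + 1))) :
    Subsingleton (Abelian.Ext X S.X₁ (i + 1)) := by
  refine subsingleton_of_forall_eq 0 fun z => ?_
  obtain ⟨a, rfl⟩ := Abelian.Ext.covariant_sequence_exact₁ X hS z (h₂.elim _ _) rfl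
  rw [h₃.elim a 0, Abelian.Ext.zero_comp]

lemma subsingleton_ext_X₃_right (hS : S.ShortExact) {X : ModuleCat.{u} R} {i : ℕ}
    (h₂ : Subsingleton (Abelian.Ext X S.X₂ i)) (h₁ : Subsingleton (Abelian.Ext X S.X₁ (i + 1))) :
    Subsingleton (Abelian.Ext X S.X₃ i) := by
  refine subsingleton_of_forall_eq 0 fun z => ?_
  obtain ⟨a, rfl⟩ := Abelian.Ext.covariant_sequence_exact₃ X hS z rfl (h₁.elim _ _)
  rw [h₂.elim a 0, Abelian.Ext.zero_comp]

lemma subsingleton_ext_X₂_left (hS : S.ShortExact) {Y : ModuleCat.{u} R} {i : ℕ}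
    (h₁ : Subsingleton (Abelian.Ext S.X₁ Y i)) (h₃ : Subsingleton (Abelian.Ext S.X₃ Y i)) :
    Subsingleton (Abelian.Ext S.X₂ Y i) := by
  refine subsingleton_of_forall_eq 0 fun z => ?_
  obtain ⟨a, rfl⟩ := Abelian.Ext.contravariant_sequence_exact₂ hS Y z (h₁.elim _ _)
  rw [h₃.elim a 0, Abelian.Ext.comp_zero]

lemma subsingleton_ext_X₁_left (hS : S.ShortExact) {Y : ModuleCat.{u} R} {i : ℕ}
    (h₂ : Subsingleton (Abelian.Ext S.X₂ Y i)) (h₃ : Subsingleton (Abelian.Ext S.X₃ Y (i + 1))) :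
    Subsingleton (Abelian.Ext S.X₁ Y i) := by
  refine subsingleton_of_forall_eq 0 fun z => ?_
  obtain ⟨a, rfl⟩ := Abelian.Ext.contravariant_sequence_exact₁ hS Y z (add_comm 1 i) (h₃.elim _ _)
  rw [h₂.elim a 0, Abelian.Ext.comp_zero]

lemma exists_f_comp_eq_of_subsingleton_ext (hS : S.ShortExact) {Y : ModuleCat.{u} R}
    (h₃ : Subsingleton (Abelian.Ext S.X₃ Y 1)) (φ : S.X₁ ⟶ Y) : ∃ ψ : S.X₂ ⟶ Y, S.f ≫ ψ = φ := by
  obtain ⟨a, ha⟩ := Abelian.Ext.contravariant_sequence_exact₁ hS Y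
    (Abelian.Ext.mk₀ φ) (add_zero 1) (h₃.elim _ _)
  obtain ⟨b, rfl⟩ := Abelian.Ext.addEquiv₀.symm.surjective a
  refine ⟨b, Abelian.Ext.addEquiv₀.symm.injective ?_⟩
  change Abelian.Ext.mk₀ (S.f ≫ b) = Abelian.Ext.mk₀ φ
  rw [← ha, ← Abelian.Ext.mk₀_comp_mk₀]
  rfl

lemma ext_eq_smul_of_smul_id {X Y : ModuleCat.{u} R} (x : R) {i : ℕ}
    (a : Abelian.Ext X Y i) : (Abelian.Ext.mk₀ (x • 𝟙 X)).comp a (zero_add i) = x • a := by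
  rw [Abelian.Ext.mk₀_smul, Abelian.Ext.smul_comp, Abelian.Ext.mk₀_id_comp]

end ShortComplex

/-- The short complex of modules given by an exact pair of linear maps. -/
abbrev shortComplexOfExact (f : A →ₗ[R] B) (g : B →ₗ[R] C) (h : Function.Exact f g) :
    ShortComplex (ModuleCat.{u} R) :=
  ShortComplex.moduleCatMk f g h.linearMap_comp_eq_zero

lemma shortExact_shortComplexOfExact {f : A →ₗ[R] B} {g : B →ₗ[R] C}
    (hf : Function.Injective f) (h : Function.Exact f g) (hg : Function.Surjective g) :
    (shortComplexOfExact f g h).ShortExact :=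
  ModuleCat.shortComplex_shortExact _ h hf hg

variable {f : A →ₗ[R] B} {g : B →ₗ[R] C}

lemma ExtVanishes.of_linearEquiv_right (e : A ≃ₗ[R] B) {i : ℕ} (h : ExtVanishes R X A i) :
    ExtVanishes R X B i :=
  ((Abelian.extFunctorObj (ModuleCat.of R X) i).mapIso
    e.toModuleIso).addCommGroupIsoToAddEquiv.toEquiv.subsingleton_congr.mp h

lemma ExtVanishes.of_linearEquiv_left (e : A ≃ₗ[R] B) {i : ℕ} (h : ExtVanishes R A X i) :
    ExtVanishes R B X i := by
  refine subsingleton_of_forall_eq 0 fun z => ?_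
  have h1 : (Abelian.Ext.mk₀ e.toModuleIso.hom).comp z (zero_add i) = 0 := h.elim _ _
  rw [← Abelian.Ext.mk₀_id_comp z, ← e.toModuleIso.inv_hom_id, ← Abelian.Ext.mk₀_comp_mk₀_assoc,
    h1, Abelian.Ext.comp_zero]

lemma ExtVanishes.middle_right (hf : Function.Injective f) (h : Function.Exact f g)
    (hg : Function.Surjective g) {i : ℕ} (hA : ExtVanishes R X A i) (hC : ExtVanishes R X C i) :
    ExtVanishes R X B i :=
  subsingleton_ext_X₂_right (shortExact_shortComplexOfExact hf h hg) hA hC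

lemma ExtVanishes.left_right (hf : Function.Injective f) (h : Function.Exact f g)
    (hg : Function.Surjective g) {i : ℕ} (hC : ExtVanishes R X C i)
    (hB : ExtVanishes R X B (i + 1)) : ExtVanishes R X A (i + 1) :=
  subsingleton_ext_X₁_right (shortExact_shortComplexOfExact hf h hg) hC hB

lemma ExtVanishes.right_right (hf : Function.Injective f) (h : Function.Exact f g)
    (hg : Function.Surjective g) {i : ℕ} (hB : ExtVanishes R X B i)
    (hA : ExtVanishes R X A (i + 1)) : ExtVanishes R X C i :=
  subsingleton_ext_X₃_right (shortExact_shortComplexOfExact hf h hg) hB hA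

lemma ExtVanishes.middle_left (hf : Function.Injective f) (h : Function.Exact f g)
    (hg : Function.Surjective g) {i : ℕ} (hA : ExtVanishes R A Y i) (hC : ExtVanishes R C Y i) :
    ExtVanishes R B Y i :=
  subsingleton_ext_X₂_left (shortExact_shortComplexOfExact hf h hg) hA hC

lemma ExtVanishes.left_left (hf : Function.Injective f) (h : Function.Exact f g)
    (hg : Function.Surjective g) {i : ℕ} (hB : ExtVanishes R B Y i)
    (hC : ExtVanishes R C Y (i + 1)) : ExtVanishes R A Y i :=
  subsingleton_ext_X₁_left (shortExact_shortComplexOfExact hf h hg) hB hC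

lemma extVanishes_of_subsingleton_left [Subsingleton X] (i : ℕ) : ExtVanishes R X Y i := by
  refine subsingleton_of_forall_eq 0 fun z => ?_
  have : 𝟙 (ModuleCat.of R X) = 0 := (ModuleCat.isZero_of_subsingleton _).eq_of_src _ _
  rw [← Abelian.Ext.mk₀_id_comp z, this, Abelian.Ext.mk₀_zero, Abelian.Ext.zero_comp]

lemma extVanishes_of_subsingleton_right [Subsingleton Y] (i : ℕ) : ExtVanishes R X Y i := by
  refine subsingleton_of_forall_eq 0 fun z => ?_
  have : 𝟙 (ModuleCat.of R Y) = 0 := (ModuleCat.isZero_of_subsingleton _).eq_of_src _ _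
  rw [← Abelian.Ext.comp_mk₀_id z, this, Abelian.Ext.mk₀_zero, Abelian.Ext.comp_zero]

lemma extVanishes_of_projective [Module.Projective R X] (i : ℕ) : ExtVanishes R X Y (i + 1) := by
  have : Projective (ModuleCat.of R X) := (IsProjective.iff_projective X).mp inferInstance
  exact subsingleton_of_forall_eq 0 fun z => Abelian.Ext.eq_zero_of_projective z

lemma extVanishes_zero_iff : ExtVanishes R X Y 0 ↔ Subsingleton (X →ₗ[R] Y) :=
  (Abelian.Ext.addEquiv₀.trans ModuleCat.homAddEquiv).toEquiv.subsingleton_congr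

/-- A linear map on the kernel extends if `Ext^1` of the quotient vanishes. -/
lemma exists_comp_eq_of_extVanishes_one (hf : Function.Injective f) (h : Function.Exact f g)
    (hg : Function.Surjective g) (hC : ExtVanishes R C Y 1) (φ : A →ₗ[R] Y) :
    ∃ ψ : B →ₗ[R] Y, ψ ∘ₗ f = φ := by
  obtain ⟨ψ, hψ⟩ := exists_f_comp_eq_of_subsingleton_ext
    (shortExact_shortComplexOfExact hf h hg) hC (ModuleCat.ofHom φ)
  exact ⟨ψ.hom, congrArg ModuleCat.Hom.hom hψ⟩

/-- Nakayama for `Ext`: if `Ext^{i+1}(X/xX, Y) = 0` for an `X`-regular `x ∈ 𝔪` then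
`Ext^i(X, Y) = 0`. -/
lemma ExtVanishes.of_quotSMulTop_left [IsNoetherianRing R] [IsLocalRing R] [Module.Finite R X]
    [Module.Finite R Y] {x : R} (hx : x ∈ maximalIdeal R) (hreg : IsSMulRegular X x) {i : ℕ}
    (h : ExtVanishes R (QuotSMulTop x X) Y (i + 1)) : ExtVanishes R X Y i := by
  -- The vanishing makes multiplication by x surjective on `Ext^i(X, Y)`, which is a finite module,
  -- so Nakayama applies.
  have key : ∀ z : Abelian.Ext (ModuleCat.of R X) (ModuleCat.of R Y) i,
      ∃ w : Abelian.Ext (ModuleCat.of R X) (ModuleCat.of R Y) i, x • w = z := by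
    intro z
    obtain ⟨a, ha⟩ := Abelian.Ext.contravariant_sequence_exact₁
      (IsSMulRegular.smulShortComplex_shortExact (M := ModuleCat.of R X) hreg)
      (ModuleCat.of R Y) z (add_comm 1 i) (h.elim _ _)
    exact ⟨a, (ext_eq_smul_of_smul_id x a).symm.trans ha⟩
  rw [ExtVanishes, ← Submodule.subsingleton_iff R, ← subsingleton_iff_bot_eq_top]
  refine (Submodule.eq_bot_of_le_smul_of_le_jacobson_bot (maximalIdeal R) _
    Module.Finite.fg_top ?_ (IsLocalRing.maximalIdeal_le_jacobson _)).symm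
  intro z _
  obtain ⟨w, rfl⟩ := key z
  exact Submodule.smul_mem_smul hx trivial

end ExtLemmas


/-! ### Depth through Ext from the residue field -/

section Depth

open scoped Pointwise

variable {R : Type u} [CommRing R] [IsLocalRing R]
  {A B C X Y : Type u} [AddCommGroup A] [Module R A] [AddCommGroup B] [Module R B]
  [AddCommGroup C] [Module R C] [AddCommGroup X] [Module R X] [AddCommGroup Y] [Module R Y]

/-- `depth X ≥ n`, expressed by the vanishing of `Ext^i(k, X)` for `i < n`. -/
def DepthGE (R : Type u) [CommRing R] [IsLocalRing R] (n : ℕ)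
    (X : Type u) [AddCommGroup X] [Module R X] : Prop :=
  ∀ i < n, ExtVanishes R (ResidueField R) X i

lemma DepthGE.mono {m n : ℕ} (h : DepthGE R n X) (hmn : m ≤ n) : DepthGE R m X :=
  fun i hi => h i (hi.trans_le hmn)

lemma depthGE_zero : DepthGE R 0 X := fun i hi => absurd hi (Nat.not_lt_zero i)

lemma DepthGE.congr {n : ℕ} (e : X ≃ₗ[R] Y) (h : DepthGE R n X) : DepthGE R n Y :=
  fun i hi => (h i hi).of_linearEquiv_right e

lemma depthGE_of_subsingleton [Subsingleton X] (n : ℕ) : DepthGE R n X :=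
  fun i _ => extVanishes_of_subsingleton_right i

lemma depthGE_one_of_injective {f : A →ₗ[R] B} (hf : Function.Injective f)
    (hB : DepthGE R 1 B) : DepthGE R 1 A := by
  intro i hi
  obtain rfl : i = 0 := by omega
  have := extVanishes_zero_iff.mp (hB 0 one_pos)
  refine extVanishes_zero_iff.mpr (subsingleton_of_forall_eq 0 fun g => ?_)
  have h : f ∘ₗ g = 0 := Subsingleton.elim _ _
  ext x
  exact hf (by simpa using congr($h x))

variable {f : A →ₗ[R] B} {g : B →ₗ[R] C} {n : ℕ}

lemma DepthGE.left (hf : Function.Injective f) (h : Function.Exact f g)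
    (hg : Function.Surjective g) (hB : DepthGE R (n + 1) B) (hC : DepthGE R n C) :
    DepthGE R (n + 1) A := by
  rintro (_ | i) hi
  · exact depthGE_one_of_injective hf (hB.mono (by omega)) 0 one_pos
  · exact ExtVanishes.left_right hf h hg (hC i (by omega)) (hB _ hi)

lemma DepthGE.middle (hf : Function.Injective f) (h : Function.Exact f g)
    (hg : Function.Surjective g) (hA : DepthGE R n A) (hC : DepthGE R n C) :
    DepthGE R n B :=
  fun i hi => ExtVanishes.middle_right hf h hg (hA i hi) (hC i hi)

lemma DepthGE.right (hf : Function.Injective f) (h : Function.Exact f g)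
    (hg : Function.Surjective g) (hB : DepthGE R n B) (hA : DepthGE R (n + 1) A) :
    DepthGE R n C :=
  fun i hi => ExtVanishes.right_right hf h hg (hB i hi) (hA _ (by omega))

lemma DepthGE.quotSMulTop {x : R} (hx : IsSMulRegular X x) (h : DepthGE R (n + 1) X) :
    DepthGE R n (QuotSMulTop x X) :=
  DepthGE.right (f := LinearMap.lsmul R X x) (g := (x • (⊤ : Submodule R X)).mkQ) hx
    (LinearMap.exact_lsmul_mkQ_smul_top X x) (Submodule.mkQ_surjective _)
    (h.mono (Nat.le_succ n)) h

lemma DepthGE.pi (h : DepthGE R n X) : ∀ m : ℕ, DepthGE R n (Fin m → X)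
  | 0 => depthGE_of_subsingleton n
  | m + 1 => by
    refine DepthGE.middle (f := LinearMap.single R (fun _ : Fin (m + 1) => X) 0)
      (g := LinearMap.funLeft R X Fin.succ)
      (Pi.single_injective (M := fun _ : Fin (m + 1) => X) 0) ?_ ?_ h (DepthGE.pi h m)
    · intro y
      constructor
      · intro hy
        refine ⟨y 0, ?_⟩
        ext j
        refine Fin.cases ?_ (fun j => ?_) j
        · simp
        · simpa using (congr_fun hy j).symm
      · rintro ⟨a, rfl⟩
        ext j
        simp [LinearMap.funLeft_apply]
    · exact LinearMap.funLeft_surjective_of_injective R X _ (Fin.succ_injective m)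

lemma DepthGE.linearMap_of_free {F : Type u} [AddCommGroup F] [Module R F] [Module.Free R F]
    [Module.Finite R F] (h : DepthGE R n X) : DepthGE R n (F →ₗ[R] X) := by
  let b := Module.finBasis R F
  exact (h.pi _).congr (b.constr R)

variable [IsNoetherianRing R]

lemma DepthGE.exists_isSMulRegular [Module.Finite R X] (h : DepthGE R (n + 1) X) :
    ∃ x ∈ maximalIdeal R, IsSMulRegular X x := by
  have := extVanishes_zero_iff.mp (h 0 n.succ_pos)
  obtain ⟨x, hx, hreg⟩ := IsSMulRegular.subsingleton_linearMap_iff.mp this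
  refine ⟨x, ?_, hreg⟩
  have h1 : Module.annihilator R (ResidueField R) = maximalIdeal R :=
    Ideal.annihilator_quotient
  rwa [h1] at hx

/-- Rees' theorem translates regular sequences into Ext vanishing. The zero module satisfies both
sides, as its Ext groups all vanish. -/
lemma isMaximalCohenMacaulay_iff {d : ℕ} (hd : ringKrullDim R = d) :
    IsMaximalCohenMacaulay R X ↔ Module.Finite R X ∧ DepthGE R d X := by
  have hsupp : Module.support R (ResidueField R) = PrimeSpectrum.zeroLocus (maximalIdeal R) := by
    rw [Module.support_eq_zeroLocus]
    exact congrArg (fun I : Ideal R => PrimeSpectrum.zeroLocus (I : Set R))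
      Ideal.annihilator_quotient
  refine and_congr_right fun hfin => ?_
  rcases subsingleton_or_nontrivial X with hX | hX
  · exact ⟨fun _ => depthGE_of_subsingleton d, fun _ h => absurd h (not_nontrivial X)⟩
  · have hlt : maximalIdeal R • (⊤ : Submodule R X) < ⊤ :=
      (Submodule.top_ne_ideal_smul_of_le_jacobson_annihilator
        (IsLocalRing.maximalIdeal_le_jacobson _)).symm.lt_top
    constructor
    · intro h
      obtain ⟨rs, hrs, hreg, hlen⟩ := h hX
      have hlen' : rs.length = d := by rw [hd] at hlen; exact_mod_cast hlen
      have := ModuleCat.subsingleton_ext_of_exists_isRegular (maximalIdeal R)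
        (ModuleCat.of R (ResidueField R)) hsupp.le (ModuleCat.of R X) hlt rs hrs hreg
      rw [hlen'] at this
      exact this
    · intro h _
      obtain ⟨rs, hlen, hrs, hreg⟩ := ModuleCat.exists_isRegular_of_exists_subsingleton_ext
        (maximalIdeal R) d (ModuleCat.of R X) hlt (ModuleCat.of R (ResidueField R)) hsupp h
      exact ⟨rs, hrs, hreg, by rw [hlen, hd]⟩

/-- `depth X ≤ dim R/q` for every associated prime `q` of `X`. -/
lemma DepthGE.le_ringKrullDim_quotient [Module.Finite R X] (h : DepthGE R n X)
    {q : Ideal R} (hq : IsAssociatedPrime q X) : (n : WithBot ℕ∞) ≤ ringKrullDim (R ⧸ q) := by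
  induction n generalizing X q with
  | zero =>
    have := hq.isPrime
    exact ringKrullDim_nonneg_of_nontrivial
  | succ n ih =>
    obtain ⟨x, hx, hreg⟩ := h.exists_isSMulRegular
    have hqp := hq.isPrime
    obtain ⟨_, z, hz⟩ := isAssociatedPrime_iff.mp hq
    -- the submodule of elements killed by `q`
    let T : Submodule R X :=
      { carrier := {m | ∀ r ∈ q, r • m = 0}
        add_mem' := fun ha hb r hr => by rw [smul_add, ha r hr, hb r hr, add_zero]
        zero_mem' := fun r _ => smul_zero r
        smul_mem' := fun c m hm r hr => by rw [smul_comm, hm r hr, smul_zero] }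
    have hzT : z ∈ T := fun r hr => by
      rw [hz] at hr
      simpa [Submodule.mem_colon_singleton] using hr
    have hz0 : z ≠ 0 := by
      rintro rfl
      exact hqp.ne_top (by rw [hz]; ext; simp)
    have hxq : x ∉ q := fun hxq => hz0 (hreg (by simpa using hzT x hxq))
    -- some element of `T` is not in `xX`
    obtain ⟨w, hwT, hwx⟩ : ∃ w ∈ T, w ∉ x • (⊤ : Submodule R X) := by
      by_contra! hcon
      -- As x is regular, an element of T divisible by x has its quotient again in T. If `T ⊆ xX`,
      -- then `T = xT`, against Nakayama.
      have hT : T ≤ maximalIdeal R • T := by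
        intro m hm
        obtain ⟨m', -, rfl⟩ := Submodule.mem_smul_pointwise_iff_exists _ _ _ |>.mp (hcon m hm)
        refine Submodule.smul_mem_smul hx fun r hr => hreg ?_
        have := hm r hr
        rw [smul_comm] at this
        simpa using this
      have := Submodule.eq_bot_of_le_smul_of_le_jacobson_bot _ T
        (IsNoetherian.noetherian T) hT (IsLocalRing.maximalIdeal_le_jacobson _)
      exact hz0 (by simpa [this] using hzT)
    obtain ⟨p, hp, hpw⟩ := exists_le_isAssociatedPrime_of_isNoetherianRing R
      (Submodule.Quotient.mk (p := x • (⊤ : Submodule R X)) w)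
      (by rwa [Ne, Submodule.Quotient.mk_eq_zero])
    have hpp := hp.isPrime
    have hqp' : q ≤ p := fun r hr => hpw (by
      rw [Submodule.mem_colon_singleton, ← Submodule.Quotient.mk_smul, hwT r hr]
      simp)
    have hxp : x ∈ p := hpw (by
      rw [Submodule.mem_colon_singleton, ← Submodule.Quotient.mk_smul, Submodule.mem_bot,
        Submodule.Quotient.mk_eq_zero]
      exact Submodule.smul_mem_pointwise_smul _ _ _ trivial)
    -- The prime p is associated to `X/xX` and contains q and x, while x lies outside q. Depth drops
    -- by one and `dim R/p` is smaller than `dim R/q` by at least one.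
    have h1 := ih (h.quotSMulTop hreg) hp
    have h2 : ringKrullDim (R ⧸ p) + 1 ≤ ringKrullDim (R ⧸ q) :=
      ringKrullDim_succ_le_of_surjective (r := Ideal.Quotient.mk q x) (Ideal.Quotient.factor hqp')
        (Ideal.Quotient.factor_surjective hqp')
        (mem_nonZeroDivisors_of_ne_zero (by rwa [Ne, Ideal.Quotient.eq_zero_iff_mem]))
        (by simpa [Ideal.Quotient.eq_zero_iff_mem] using hxp)
    push_cast
    exact (add_le_add_left h1 1).trans h2

end Depth


/-! ### Modules of finite injective dimension over a Cohen-Macaulay ring -/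

section FiniteInjectiveDimension

variable {R : Type u} [CommRing R] [IsLocalRing R] [IsNoetherianRing R]

/-- Dividing by a regular sequence of length d leaves dimension zero, so every associated prime of
the quotient is maximal. -/
lemma exists_injective_residueField_quotient_ofList {d : ℕ} (hd : ringKrullDim R = d)
    {rs : List R} (hreg : RingTheory.Sequence.IsRegular R rs) (hlen : rs.length = d) :
    ∃ f : ResidueField R →ₗ[R] R ⧸ Ideal.ofList rs, Function.Injective f := by
  have hne : Ideal.ofList rs ≠ ⊤ := fun h => hreg.top_ne_smul (by rw [h]; simp)
  have : Nontrivial (R ⧸ Ideal.ofList rs) := Ideal.Quotient.nontrivial_iff.mpr hne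
  obtain ⟨p, hp⟩ := associatedPrimes.nonempty R (R ⧸ Ideal.ofList rs)
  have hpp : p.IsPrime := hp.isPrime
  have hle : Ideal.ofList rs ≤ p := by
    have := IsAssociatedPrime.annihilator_le hp
    rwa [Submodule.annihilator_top, Ideal.annihilator_quotient] at this
  have hdim : ringKrullDim (R ⧸ Ideal.ofList rs) = 0 := by
    have := ringKrullDim_add_length_eq_ringKrullDim_of_isRegular rs hreg
    rw [hd, hlen] at this
    exact (ENat.WithBot.add_natCast_cancel (c := d)).mp (by simpa using this)
  have hp0 : Ring.KrullDimLE 0 (R ⧸ p) := by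
    rw [Ring.krullDimLE_iff]
    exact (ringKrullDim_le_of_surjective (Ideal.Quotient.factor hle)
      (Ideal.Quotient.factor_surjective hle)).trans hdim.le
  have hpm : p.IsMaximal :=
    Ideal.Quotient.maximal_of_isField p Ring.KrullDimLE.isField_of_isDomain
  obtain rfl := IsLocalRing.eq_maximalIdeal hpm
  exact ((isAssociatedPrime_iff_exists_injective_linearMap _ _).mp hp).2

variable {Y : Type u} [AddCommGroup Y] [Module R Y]

lemma extVanishes_quotient_ofList {rs : List R} (hreg : RingTheory.Sequence.IsRegular R rs)
    {j : ℕ} (hj : rs.length < j) : ExtVanishes R (R ⧸ Ideal.ofList rs) Y j := by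
  have h1 := ModuleCat.projectiveDimension_quotient_eq_length.{u, u} rs hreg
  have h2 := (projectiveDimension_le_iff _ _).mp h1.le
  have h3 : ExtVanishes R (Shrink.{u} (R ⧸ Ideal.ofList rs)) Y j :=
    HasProjectiveDimensionLT.subsingleton _ (rs.length + 1) j hj _
  exact h3.of_linearEquiv_left (Shrink.linearEquiv R _)

variable [Module.Finite R Y]

/-- A finite module of finite injective dimension over a Cohen-Macaulay local ring has injective
dimension at most `dim R`. -/
theorem HasFiniteInjectiveDimension.extVanishes (hR : IsCohenMacaulayLocal R) {d : ℕ}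
    (hd : ringKrullDim R = d) (hY : HasFiniteInjectiveDimension R Y) {j : ℕ} (hj : d < j)
    (X : Type u) [AddCommGroup X] [Module R X] [Module.Finite R X] : ExtVanishes R X Y j := by
  obtain ⟨n, hn⟩ := hY
  obtain ⟨rs, -, hreg, hlen⟩ := hR.2 inferInstance
  have hlen : rs.length = d := by rw [hd] at hlen; exact_mod_cast hlen
  obtain ⟨ι, hι⟩ := exists_injective_residueField_quotient_ofList hd hreg hlen
  -- Descending induction on j: m bounds how far j lies below the degrees where injective dimension
  -- n already forces vanishing.
  obtain ⟨m, hm⟩ : ∃ m, n + 1 ≤ j + m := ⟨n + 1, by omega⟩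
  induction m generalizing j X with
  | zero => exact HasInjectiveDimensionLT.subsingleton (ModuleCat.of R Y) (n + 1) j hm _
  | succ m ih =>
    have H : ∀ (X : Type u) [AddCommGroup X] [Module R X] [Module.Finite R X],
        ExtVanishes R X Y (j + 1) := fun X => ih (by omega) X (by omega)
    induction ‹Module.Finite R X› using
      IsNoetherianRing.induction_on_isQuotientEquivQuotientPrime R with
    | subsingleton N => exact extVanishes_of_subsingleton_left j
    | exact N₁ N₂ N₃ f g hf hg hfg h₁ h₃ => exact ExtVanishes.middle_left hf hfg hg h₁ h₃
    | quotient N p e =>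
      by_cases hp : p.1 = maximalIdeal R
      · have hk : ExtVanishes R (ResidueField R) Y j :=
          ExtVanishes.left_left hι (LinearMap.exact_map_mkQ_range ι)
            (Submodule.mkQ_surjective _) (extVanishes_quotient_ofList hreg (by omega)) (H _)
        exact hk.of_linearEquiv_left ((Submodule.quotEquivOfEq _ _ hp.symm).trans e.symm)
      · obtain ⟨x, hx, hxp⟩ := SetLike.exists_of_lt
          (lt_of_le_of_ne (IsLocalRing.le_maximalIdeal p.2.ne_top) hp)
        have hreg : IsSMulRegular N x := by
          intro a b hab
          apply e.injective
          have h1 : x • e a = x • e b := by rw [← map_smul, ← map_smul]; exact congrArg e hab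
          have h2 : Ideal.Quotient.mk p.1 x * (e a - e b) = 0 := by
            have : x • (e a - e b) = 0 := by rw [smul_sub, h1, sub_self]
            simpa [Algebra.smul_def] using this
          have hpp := p.2
          refine sub_eq_zero.mp ((mul_eq_zero.mp h2).resolve_left ?_)
          rwa [Ideal.Quotient.eq_zero_iff_mem]
        exact ExtVanishes.of_quotSMulTop_left hx hreg (H _)

/-- Each X-regular element trades one unit of depth for one Ext degree, until the degree exceeds d.
-/
theorem HasFiniteInjectiveDimension.extVanishes_of_depthGE (hR : IsCohenMacaulayLocal R) {d : ℕ}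
    (hd : ringKrullDim R = d) (hY : HasFiniteInjectiveDimension R Y) {t i : ℕ} (hi : d < i + t)
    {X : Type u} [AddCommGroup X] [Module R X] [Module.Finite R X] (hX : DepthGE R t X) :
    ExtVanishes R X Y i := by
  induction t generalizing i X with
  | zero => exact hY.extVanishes hR hd hi X
  | succ t ih =>
    obtain ⟨x, hx, hreg⟩ := hX.exists_isSMulRegular
    exact ExtVanishes.of_quotSMulTop_left hx hreg (ih (by omega) (hX.quotSMulTop hreg))

end FiniteInjectiveDimension

/-! ### The natural map from M ⊗ Hom(N, W) to Hom(Hom(M, N), W) -/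

section HomTensor

variable {R : Type u} [CommRing R]
  {M N W : Type u} [AddCommGroup M] [Module R M] [AddCommGroup N] [Module R N]
  [AddCommGroup W] [Module R W]

variable (R M N W) in
/-- The natural map `M ⊗ Hom(N, W) → Hom(Hom(M, N), W)`. -/
def tensorHomToHomHom : M ⊗[R] (N →ₗ[R] W) →ₗ[R] ((M →ₗ[R] N) →ₗ[R] W) :=
  TensorProduct.lift (LinearMap.mk₂ R (fun m φ => φ ∘ₗ LinearMap.applyₗ m)
    (fun _ _ _ => by ext; simp) (fun _ _ _ => by ext; simp)
    (fun _ _ _ => by ext; simp) (fun _ _ _ => by ext; simp))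

@[simp]
lemma tensorHomToHomHom_tmul (m : M) (φ : N →ₗ[R] W) (f : M →ₗ[R] N) :
    tensorHomToHomHom R M N W (m ⊗ₜ φ) f = φ (f m) := rfl

lemma tensorHomToHomHom_rTensor {L : Type u} [AddCommGroup L] [Module R L] (π : L →ₗ[R] M)
    (y : L ⊗[R] (N →ₗ[R] W)) (f : M →ₗ[R] N) :
    tensorHomToHomHom R M N W (π.rTensor (N →ₗ[R] W) y) f =
      tensorHomToHomHom R L N W y (f ∘ₗ π) := by
  induction y with
  | zero => simp
  | tmul a b => simp
  | add a b ha hb => simp [ha, hb]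

lemma tensorHomToHomHom_bijective_of_free [Module.Free R M] [Module.Finite R M] :
    Function.Bijective (tensorHomToHomHom R M N W) := by
  classical
  let b := Module.Free.chooseBasis R M
  -- `E i` sends n to the map with value n on `b i` and zero on the other basis vectors; these maps
  -- decompose `Hom(M, N)` into copies of N.
  let E (i) : N →ₗ[R] (M →ₗ[R] N) := LinearMap.smulRightₗ (b.coord i)
  let inv : ((M →ₗ[R] N) →ₗ[R] W) → M ⊗[R] (N →ₗ[R] W) := fun ψ => ∑ i, b i ⊗ₜ (ψ ∘ₗ E i)
  refine Function.bijective_iff_has_inverse.mpr ⟨inv, fun z => ?_, fun ψ => ?_⟩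
  · induction z with
    | zero => simp [inv]
    | add x y hx hy =>
      conv_rhs => rw [← hx, ← hy]
      simp [inv, LinearMap.add_comp, TensorProduct.tmul_add, Finset.sum_add_distrib]
    | tmul m φ =>
      have h : ∀ i, tensorHomToHomHom R M N W (m ⊗ₜ φ) ∘ₗ E i = b.coord i m • φ := by
        intro i; ext n; simp [E]
      simp only [inv, h, TensorProduct.tmul_smul, TensorProduct.smul_tmul',
        ← TensorProduct.sum_tmul]
      congr 1
      exact b.sum_repr m
  · ext f
    simp only [inv, map_sum, LinearMap.sum_apply, tensorHomToHomHom_tmul, LinearMap.comp_apply]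
    rw [← map_sum]
    congr 1
    refine b.ext fun j => ?_
    simp [E, LinearMap.sum_apply, Finsupp.single_apply]

variable {F : Type u} [AddCommGroup F] [Module R F] {π : F →ₗ[R] M}

variable (N π) in
/-- Restriction of linear maps to the kernel of `π`. -/
abbrev restrictKer : (F →ₗ[R] N) →ₗ[R] (LinearMap.ker π →ₗ[R] N) :=
  LinearMap.lcomp R N (LinearMap.ker π).subtype

lemma lcomp_injective_of_surjective (hπ : Function.Surjective π) :
    Function.Injective (LinearMap.lcomp R N π) := by
  intro f g h
  ext m
  obtain ⟨v, rfl⟩ := hπ m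
  exact congr($h v)

lemma exact_lcomp_restrictKer (hπ : Function.Surjective π) :
    Function.Exact (LinearMap.lcomp R N π) (restrictKer N π) := by
  intro f
  constructor
  · intro hf
    have hk : LinearMap.ker π ≤ LinearMap.ker f := fun v hv => congr($hf ⟨v, hv⟩)
    refine ⟨(LinearMap.ker π).liftQ f hk ∘ₗ (π.quotKerEquivOfSurjective hπ).symm, ?_⟩
    ext v
    have : (π.quotKerEquivOfSurjective hπ).symm (π v) = Submodule.Quotient.mk v := by
      rw [LinearEquiv.symm_apply_eq]; rfl
    simp [this]
  · rintro ⟨g, rfl⟩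
    ext ⟨v, hv⟩
    have : π v = 0 := hv
    simp [this]

lemma exact_lcomp_rangeRestrict_restrictKer (hπ : Function.Surjective π) :
    Function.Exact (LinearMap.lcomp R N π) (restrictKer N π).rangeRestrict := by
  intro f
  rw [← exact_lcomp_restrictKer hπ f, ← LinearMap.mem_ker, LinearMap.ker_rangeRestrict,
    LinearMap.mem_ker]

lemma restrictKer_surjective (hπ : Function.Surjective π) (h : ExtVanishes R M N 1) :
    Function.Surjective (restrictKer N π) := fun φ =>
  exists_comp_eq_of_extVanishes_one (LinearMap.ker π).injective_subtype
    (LinearMap.exact_subtype_ker_map π) hπ h φ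

variable [Module.Free R F] [Module.Finite R F]

/-- The cokernel of `Hom(M, N) → Hom(F, N)` is the module of maps on the kernel of π that extend to
F. Vanishing of its `Ext^1` extends a functional from `Hom(M, N)` to `Hom(F, N)`, where the free
case gives a preimage. -/
lemma tensorHomToHomHom_surjective (hπ : Function.Surjective π)
    (h : ExtVanishes R (LinearMap.range (restrictKer N π)) W 1) :
    Function.Surjective (tensorHomToHomHom R M N W) := by
  intro χ
  obtain ⟨ψ, hψ⟩ := exists_comp_eq_of_extVanishes_one (lcomp_injective_of_surjective hπ)
    (exact_lcomp_rangeRestrict_restrictKer hπ) (LinearMap.surjective_rangeRestrict _) h χ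
  obtain ⟨y, hy⟩ := (tensorHomToHomHom_bijective_of_free (R := R) (M := F) (N := N) (W := W)).2 ψ
  refine ⟨π.rTensor (N →ₗ[R] W) y, ?_⟩
  ext f
  rw [tensorHomToHomHom_rTensor, hy, ← hψ]
  rfl

/-- A diagram chase: lift an element of the kernel to y over F. Its image vanishes on maps factoring
through π, so it descends to a functional on `Hom(ker π, N)`. Surjectivity for `ker π` shows that y
comes from `ker π`, hence dies over M. -/
lemma tensorHomToHomHom_injective (hπ : Function.Surjective π)
    (hres : Function.Surjective (restrictKer N π))
    (hker : Function.Surjective (tensorHomToHomHom R (LinearMap.ker π) N W)) :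
    Function.Injective (tensorHomToHomHom R M N W) := by
  rw [injective_iff_map_eq_zero]
  intro z hz
  obtain ⟨y, rfl⟩ := LinearMap.rTensor_surjective (N →ₗ[R] W) hπ z
  have h1 : ∀ f : F →ₗ[R] N, restrictKer N π f = 0 → tensorHomToHomHom R F N W y f = 0 := by
    intro f hf
    obtain ⟨g, rfl⟩ := (exact_lcomp_restrictKer hπ f).mp hf
    have := congr($hz g)
    rwa [tensorHomToHomHom_rTensor] at this
  let w : (LinearMap.ker π →ₗ[R] N) →ₗ[R] W :=
    (LinearMap.ker (restrictKer N π)).liftQ (tensorHomToHomHom R F N W y) h1 ∘ₗ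
      ((restrictKer N π).quotKerEquivOfSurjective hres).symm
  have hw : ∀ f, w (restrictKer N π f) = tensorHomToHomHom R F N W y f := by
    intro f
    have : ((restrictKer N π).quotKerEquivOfSurjective hres).symm (restrictKer N π f) =
        Submodule.Quotient.mk f := by
      rw [LinearEquiv.symm_apply_eq]; rfl
    simp only [w, LinearMap.comp_apply, LinearEquiv.coe_coe, this]
    rfl
  obtain ⟨v, hv⟩ := hker w
  have h2 : (LinearMap.ker π).subtype.rTensor (N →ₗ[R] W) v = y := by
    apply (tensorHomToHomHom_bijective_of_free (R := R) (M := F) (N := N) (W := W)).1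
    ext f
    rw [tensorHomToHomHom_rTensor, hv, ← hw]
    rfl
  rw [← h2, ← LinearMap.comp_apply, ← LinearMap.rTensor_comp,
    (LinearMap.exact_subtype_ker_map π).linearMap_comp_eq_zero]
  simp

end HomTensor

/-! ### Depth of Hom modules and bijectivity of the natural map -/

section Core

variable {R : Type u} [CommRing R]
  {M N : Type u} [AddCommGroup M] [Module R M] [AddCommGroup N] [Module R N]

lemma extVanishes_ker {F : Type u} [AddCommGroup F] [Module R F] [Module.Free R F]
    {π : F →ₗ[R] M} (hπ : Function.Surjective π) {i : ℕ} (h : ExtVanishes R M N (i + 2)) :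
    ExtVanishes R (LinearMap.ker π) N (i + 1) :=
  ExtVanishes.left_left (LinearMap.ker π).injective_subtype
    (LinearMap.exact_subtype_ker_map π) hπ (extVanishes_of_projective i) h

lemma ExtVanishesUpTo.ker {F : Type u} [AddCommGroup F] [Module R F] [Module.Free R F]
    {π : F →ₗ[R] M} (hπ : Function.Surjective π) {t : ℕ} (h : ExtVanishesUpTo R (t + 1) M N) :
    ExtVanishesUpTo R t (LinearMap.ker π) N := by
  intro i h1 hi
  obtain ⟨i, rfl⟩ : ∃ j, i = j + 1 := ⟨i - 1, by omega⟩
  exact extVanishes_ker hπ (h (i + 2) (by omega) (by omega))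

variable [IsLocalRing R] [IsNoetherianRing R] [Module.Finite R M]

/-- Each vanishing Ext gains one unit of depth. The range embeds in `Hom(ker π, N)`, hence in a
finite power of N, which gives depth one. When `Ext^1(M, N) = 0` the range is all of `Hom(ker π,
N)`, the kernel of a surjection from such a power onto the range belonging to the next syzygy, so
the depth lemma applies. -/
lemma depthGE_range_restrictKer {n t : ℕ} (hN : DepthGE R n N) (h : ExtVanishesUpTo R t M N)
    {F : Type u} [AddCommGroup F] [Module R F] [Module.Free R F] [Module.Finite R F]
    {π : F →ₗ[R] M} (hπ : Function.Surjective π) :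
    DepthGE R (min n (t + 1)) (LinearMap.range (restrictKer N π)) := by
  obtain ⟨G, _, _, _, _, ρ, hρ⟩ := Module.exists_finite_presentation R (LinearMap.ker π)
  rcases n with _ | n
  · exact depthGE_zero.mono (by omega)
  induction t generalizing M F G with
  | zero =>
    refine (depthGE_one_of_injective
      (f := LinearMap.lcomp R N ρ ∘ₗ (LinearMap.range (restrictKer N π)).subtype) ?_ ?_).mono
      (min_le_right _ _)
    · exact (lcomp_injective_of_surjective hρ).comp (Submodule.injective_subtype _)
    · exact (hN.mono (by omega)).linearMap_of_free
  | succ t ih =>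
    obtain ⟨G', _, _, _, _, ρ', hρ'⟩ := Module.exists_finite_presentation R (LinearMap.ker ρ)
    have hs := restrictKer_surjective (N := N) hπ (h 1 le_rfl (by omega))
    have h1 : DepthGE R (min n (t + 1) + 1) (LinearMap.ker π →ₗ[R] N) :=
      DepthGE.left (lcomp_injective_of_surjective hρ) (exact_lcomp_rangeRestrict_restrictKer hρ)
        (LinearMap.surjective_rangeRestrict _) ((hN.mono (by omega)).linearMap_of_free)
        ((ih (h.ker hπ) hρ G' ‹_› ‹_› ‹_› ‹_› ρ' hρ').mono (by omega))
    refine (h1.congr (LinearEquiv.ofTop _ (LinearMap.range_eq_top.mpr hs)).symm).mono (by omega)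

lemma DepthGE.linearMap {d : ℕ} (hN : DepthGE R d N) (h : ExtVanishesUpTo R d M N) :
    DepthGE R d (M →ₗ[R] N) := by
  obtain ⟨F, _, _, _, _, π, hπ⟩ := Module.exists_finite_presentation R M
  rcases d with _ | d
  · exact depthGE_zero
  · exact DepthGE.left (lcomp_injective_of_surjective hπ)
      (exact_lcomp_rangeRestrict_restrictKer hπ) (LinearMap.surjective_rangeRestrict _)
      hN.linearMap_of_free ((depthGE_range_restrictKer hN h hπ).mono (by omega))

theorem tensorHomToHomHom_bijective {d : ℕ} (hd : 0 < d) {W : Type u} [AddCommGroup W]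
    [Module R W] (hW : ∀ (X : Type u) [AddCommGroup X] [Module R X] [Module.Finite R X],
      DepthGE R d X → ExtVanishes R X W 1) [Module.Finite R N] (hN : DepthGE R d N)
    (h : ExtVanishesUpTo R d M N) : Function.Bijective (tensorHomToHomHom R M N W) := by
  obtain ⟨F, _, _, _, _, π, hπ⟩ := Module.exists_finite_presentation R M
  obtain ⟨G, _, _, _, _, ρ, hρ⟩ := Module.exists_finite_presentation R (LinearMap.ker π)
  obtain ⟨d, rfl⟩ : ∃ e, d = e + 1 := ⟨d - 1, by omega⟩
  refine ⟨tensorHomToHomHom_injective hπ (restrictKer_surjective hπ (h 1 le_rfl (by omega)))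
    (tensorHomToHomHom_surjective hρ (hW _ ?_)), tensorHomToHomHom_surjective hπ (hW _ ?_)⟩
  -- Passing to the syzygy loses one Ext degree; since the depth bound is `t + 1`, the remaining d -
  -- 1 degrees still give depth d.
  · exact (depthGE_range_restrictKer hN (h.ker hπ) hρ).mono (by omega)
  · exact (depthGE_range_restrictKer hN h hπ).mono (by omega)

end Core

/-! ### The tensor product as an ω-dual of End M -/

section CanonicalDual

variable {R : Type u} [CommRing R] [IsLocalRing R] [IsNoetherianRing R]
  {M N W : Type u} [AddCommGroup M] [Module R M] [Module.Finite R M] [AddCommGroup N] [Module R N]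
  [Module.Finite R N] [AddCommGroup W] [Module R W] [Module.Finite R W]

lemma DepthGE.dual (hR : IsCohenMacaulayLocal R) {d : ℕ} (hd : ringKrullDim R = d)
    (hW : HasFiniteInjectiveDimension R W) (hWd : DepthGE R d W) (hN : DepthGE R d N) :
    DepthGE R d (N →ₗ[R] W) :=
  hWd.linearMap fun _ h1 _ => hW.extVanishes_of_depthGE hR hd (by omega) hN

lemma depthGE_of_isCohenMacaulayLocal (hR : IsCohenMacaulayLocal R) {d : ℕ}
    (hd : ringKrullDim R = d) : DepthGE R d R :=
  ((isMaximalCohenMacaulay_iff hd).mp hR).2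

/-- If `Ext^i(M*, R) = 0` and `Ext^i(M, M) = 0` for `1 ≤ i ≤ dim R`, `M` is reflexive and `W` is
maximal Cohen-Macaulay of finite injective dimension, then `W ⊗ M* ⊗ M` is maximal
Cohen-Macaulay. -/
theorem depthGE_tensor_dual_tensor (hR : IsCohenMacaulayLocal R) {d : ℕ}
    (hd : ringKrullDim R = d) (hW : HasFiniteInjectiveDimension R W) (hWd : DepthGE R d W)
    [Module.IsReflexive R M] (hMM : ExtVanishesUpTo R d M M)
    (hMdual : ExtVanishesUpTo R d (Module.Dual R M) R) :
    DepthGE R d (W ⊗[R] (Module.Dual R M ⊗[R] M)) := by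
  rcases Nat.eq_zero_or_pos d with rfl | hd0
  · exact depthGE_zero
  have hE : ∀ (X : Type u) [AddCommGroup X] [Module R X] [Module.Finite R X],
      DepthGE R d X → ExtVanishes R X W 1 := fun X _ _ _ hX =>
    hW.extVanishes_of_depthGE hR hd (by omega) hX
  have hRd := depthGE_of_isCohenMacaulayLocal hR hd
  -- By reflexivity M is a dual of `M*`, and the vanishing of `Ext^i(M*, R)` gives that dual depth
  -- d.
  have hM : DepthGE R d M := (hRd.linearMap hMdual).congr (Module.evalEquiv R M).symm
  have e1 : Module.Dual R M ⊗[R] W ≃ₗ[R] (M →ₗ[R] W) :=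
    (TensorProduct.congr (LinearEquiv.refl R _) (LinearMap.ringLmapEquivSelf R R W).symm).trans
      ((LinearEquiv.ofBijective _ (tensorHomToHomHom_bijective hd0 hE hRd hMdual)).trans
        (LinearEquiv.congrLeft W R (Module.evalEquiv R M).symm))
  have e2 : M ⊗[R] (M →ₗ[R] W) ≃ₗ[R] ((M →ₗ[R] M) →ₗ[R] W) :=
    LinearEquiv.ofBijective _ (tensorHomToHomHom_bijective hd0 hE hM hMM)
  have e3 : W ⊗[R] (Module.Dual R M ⊗[R] M) ≃ₗ[R] ((M →ₗ[R] M) →ₗ[R] W) :=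
    (TensorProduct.assoc R W (Module.Dual R M) M).symm.trans
      ((TensorProduct.congr ((TensorProduct.comm R _ _).trans e1) (LinearEquiv.refl R M)).trans
        ((TensorProduct.comm R _ _).trans e2))
  exact (DepthGE.dual hR hd hW hWd (hM.linearMap hMM)).congr e3.symm

end CanonicalDual


/-! ### Regular systems of parameters -/

section RegularLocal

/-- Prime avoidance, which tolerates the one possibly nonprime ideal 𝔪². Containment of 𝔪 in 𝔪²
would give 𝔪 = 0 by Nakayama, contradicting positive dimension. -/
lemma exists_mem_maximalIdeal_notMem_sq {R : Type u} [CommRing R] [IsLocalRing R]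
    [IsNoetherianRing R] (hdim : 1 ≤ ringKrullDim R) :
    ∃ x ∈ maximalIdeal R, x ∉ maximalIdeal R ^ 2 ∧ ∀ p ∈ minimalPrimes R, x ∉ p := by
  by_contra! hcon
  have hmin : maximalIdeal R ∉ minimalPrimes R := by
    intro h
    have h0 : (maximalIdeal R).height = 0 := Ideal.height_eq_zero_iff.mpr h
    rw [← IsLocalRing.maximalIdeal_height_eq_ringKrullDim, h0] at hdim
    exact absurd hdim (by simp)
  have hsub : ((maximalIdeal R : Ideal R) : Set R) ⊆
      ⋃ I ∈ insert (maximalIdeal R ^ 2) (minimalPrimes R), (I : Set R) := by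
    intro x hx
    by_cases h2 : x ∈ maximalIdeal R ^ 2
    · exact Set.mem_biUnion (Set.mem_insert _ _) h2
    · obtain ⟨p, hp, hxp⟩ := hcon x hx h2
      exact Set.mem_biUnion (Set.mem_insert_of_mem _ hp) hxp
  obtain ⟨I, hI, hle⟩ := (Ideal.subset_union_prime_finite
    ((minimalPrimes.finite_of_isNoetherianRing R).insert (maximalIdeal R ^ 2)) (f := id)
    (maximalIdeal R ^ 2) (maximalIdeal R ^ 2) (by
      intro I hI h1 _
      exact ((Set.mem_insert_iff.mp hI).resolve_left h1).1.1)).mp hsub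
  rcases Set.mem_insert_iff.mp hI with rfl | hI
  · have hbot : maximalIdeal R = ⊥ := Submodule.eq_bot_of_le_smul_of_le_jacobson_bot
      (maximalIdeal R) _ (IsNoetherian.noetherian _) (by simpa [pow_two] using hle)
      (IsLocalRing.maximalIdeal_le_jacobson _)
    refine hmin ⟨⟨inferInstance, bot_le⟩, fun q _ _ => ?_⟩
    rw [hbot]
    exact bot_le
  · have := hI.1.1
    have heq : maximalIdeal R = I :=
      (le_antisymm hle (IsLocalRing.le_maximalIdeal this.ne_top))
    exact hmin (heq ▸ hI)

/-- A Noetherian local ring whose maximal ideal is generated by at most `dim R` elements is a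
domain and its maximal ideal is generated by a regular sequence. -/
theorem isDomain_and_exists_isRegular (n : ℕ) (R : Type u) [CommRing R] [IsLocalRing R]
    [IsNoetherianRing R] (hn : n ≤ ringKrullDim R) (s : Finset R) (hs : s.card ≤ n)
    (hspan : Ideal.span (s : Set R) = maximalIdeal R) :
    IsDomain R ∧ ∃ rs : List R, RingTheory.Sequence.IsRegular R rs ∧
      Ideal.ofList rs = maximalIdeal R := by
  classical
  induction n generalizing R with
  | zero =>
    obtain rfl : s = ∅ := Finset.card_eq_zero.mp (Nat.le_zero.mp hs)
    have hbot : maximalIdeal R = ⊥ := by rw [← hspan]; simp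
    refine ⟨?_, [], RingTheory.Sequence.IsRegular.nil R R, by rw [hbot]; simp⟩
    exact (IsLocalRing.isField_iff_maximalIdeal_eq.mpr hbot).isDomain
  | succ n ih =>
    obtain ⟨x, hx, hx2, hxmin⟩ := exists_mem_maximalIdeal_notMem_sq (R := R)
      (le_trans (by exact_mod_cast Nat.le_add_left 1 n) hn)
    obtain ⟨y, hy, hyspan⟩ : ∃ y ∈ s, y ∈ Ideal.span (insert x (s.erase y : Set R)) := by
      have hx' : x ∈ Submodule.span R (s : Set R) := by
        rw [← Ideal.span, hspan]; exact hx
      obtain ⟨a, -, ha⟩ := Submodule.mem_span_finset.mp hx'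
      -- As x is outside 𝔪², some coefficient of x in the generators is a unit, so x can replace
      -- that generator.
      obtain ⟨y, hy, hunit⟩ : ∃ y ∈ s, IsUnit (a y) := by
        by_contra! hcon
        apply hx2
        rw [← ha, pow_two]
        refine sum_mem fun y hy => ?_
        exact Ideal.mul_mem_mul ((IsLocalRing.mem_maximalIdeal _).mpr (hcon y hy))
          (hspan ▸ Ideal.subset_span hy)
      refine ⟨y, hy, ?_⟩
      rw [← Ideal.unit_mul_mem_iff_mem _ hunit]
      have h1 : a y * y = x - ∑ z ∈ s.erase y, a z • z := by
        rw [← ha, ← Finset.add_sum_erase s _ hy]; simp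
      rw [h1]
      refine sub_mem (Ideal.subset_span (Set.mem_insert _ _)) (sum_mem fun z hz => ?_)
      exact Ideal.mul_mem_left _ _ (Ideal.subset_span (Set.mem_insert_of_mem _ hz))
    have hspan' : Ideal.span (insert x (s.erase y : Set R)) = maximalIdeal R := by
      apply le_antisymm
      · rw [Ideal.span_le]
        rintro z (rfl | hz)
        · exact hx
        · exact hspan ▸ Ideal.subset_span (Finset.mem_of_mem_erase hz)
      · rw [← hspan, Ideal.span_le]
        intro z hz
        by_cases hzy : z = y
        · rw [hzy]; exact hyspan
        · exact Ideal.subset_span (Set.mem_insert_of_mem _ (Finset.mem_erase.mpr ⟨hzy, hz⟩))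
    let π := Ideal.Quotient.mk (Ideal.span {x})
    have hxne : Ideal.span {x} ≠ ⊤ := fun h => (IsLocalRing.mem_maximalIdeal x).mp hx
      (Ideal.span_singleton_eq_top.mp h)
    have : Nontrivial (R ⧸ Ideal.span {x}) := Ideal.Quotient.nontrivial_iff.mpr hxne
    have : IsLocalRing (R ⧸ Ideal.span {x}) :=
      IsLocalRing.of_surjective' π Ideal.Quotient.mk_surjective
    have hmap : (maximalIdeal R).map π = maximalIdeal (R ⧸ Ideal.span {x}) := by
      refine IsLocalRing.eq_maximalIdeal
        ((Ideal.map_eq_top_or_isMaximal_of_surjective π Ideal.Quotient.mk_surjective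
          (maximalIdeal.isMaximal R)).resolve_left fun h => ?_)
      have h2 := congrArg (Ideal.comap π) h
      rw [Ideal.comap_map_of_surjective _ Ideal.Quotient.mk_surjective, ← RingHom.ker_eq_comap_bot,
        Ideal.mk_ker, sup_eq_left.mpr ((Ideal.span_singleton_le_iff_mem _).mpr hx)] at h2
      exact (maximalIdeal.isMaximal R).ne_top h2
    obtain ⟨hdom, rs, hreg, hrs⟩ := ih (R ⧸ Ideal.span {x}) (by
        have h1 := hn.trans (ringKrullDim_le_ringKrullDim_quotient_add_card {x} (by
          rw [IsLocalRing.ringJacobson_eq_maximalIdeal]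
          simpa using hx))
        rw [Finset.coe_singleton, Finset.card_singleton] at h1
        push_cast at h1
        exact ENat.WithBot.add_le_add_one_right_iff.mp h1)
      ((s.erase y).image π) (Finset.card_image_le.trans (by
        rw [Finset.card_erase_of_mem hy]; omega)) (by
        rw [Finset.coe_image, ← Ideal.map_span, ← hmap, ← hspan', Ideal.span_insert, Ideal.map_sup]
        simp [π])
    have hprime : (Ideal.span {x}).IsPrime := (Ideal.Quotient.isDomain_iff_prime _).mp hdom
    obtain ⟨P, hP, hPle⟩ := Ideal.exists_minimalPrimes_le (J := Ideal.span {x}) (bot_le (a := _))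
    have hPp := hP.1.1
    -- An element of P is a multiple `w * x` with x outside P, so w lies in P. Hence `P = xP`, and
    -- Nakayama gives P = 0.
    have hPbot : P = ⊥ := by
      refine Submodule.eq_bot_of_le_smul_of_le_jacobson_bot (maximalIdeal R) _
        (IsNoetherian.noetherian _) (fun z hz => ?_) (IsLocalRing.maximalIdeal_le_jacobson _)
      obtain ⟨w, rfl⟩ := Ideal.mem_span_singleton'.mp (hPle hz)
      rw [mul_comm]
      exact Submodule.smul_mem_smul hx ((hPp.mem_or_mem hz).resolve_right (hxmin P hP))
    have hdomR : IsDomain R := by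
      rw [hPbot] at hPp
      exact IsDomain.of_bot_isPrime R
    refine ⟨hdomR, ?_⟩
    have hx0 : x ≠ 0 := fun h => hxmin P hP (h ▸ P.zero_mem)
    obtain ⟨ts, rfl⟩ : ∃ ts : List R, ts.map π = rs :=
      List.map_surjective_iff.mpr Ideal.Quotient.mk_surjective rs
    have hofList : Ideal.ofList (x :: ts) = maximalIdeal R := by
      have h1 : (Ideal.ofList ts).map π = (maximalIdeal R).map π := by
        rw [Ideal.map_ofList, hrs, hmap]
      have h2 := congrArg (Ideal.comap π) h1
      rw [Ideal.comap_map_of_surjective _ Ideal.Quotient.mk_surjective,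
        Ideal.comap_map_of_surjective _ Ideal.Quotient.mk_surjective, ← RingHom.ker_eq_comap_bot,
        Ideal.mk_ker, sup_eq_left.mpr ((Ideal.span_singleton_le_iff_mem _).mpr hx)] at h2
      rw [Ideal.ofList_cons, sup_comm, h2]
    refine ⟨x :: ts, ?_, hofList⟩
    refine RingTheory.Sequence.IsRegular.of_isWeaklyRegular_of_mem_maximalIdeal R
      (fun r hr => ?_) ?_
    · rw [← hofList]; exact Ideal.subset_span hr
    · refine RingTheory.Sequence.IsWeaklyRegular.cons ?_ ?_
      · exact fun a b hab => mul_left_cancel₀ hx0 hab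
      · have h1 := (RingTheory.Sequence.isWeaklyRegular_map_algebraMap_iff (R := R)
          (R ⧸ Ideal.span {x}) (R ⧸ Ideal.span {x}) ts).mp hreg.1
        refine (LinearEquiv.isWeaklyRegular_congr (Submodule.quotEquivOfEq _ _ ?_) ts).mp h1
        simp [← Submodule.ideal_span_singleton_smul]

lemma IsRegularLocalRing.exists_isRegular_ofList_eq (R : Type u) [CommRing R]
    [IsRegularLocalRing R] : ∃ rs : List R, RingTheory.Sequence.IsRegular R rs ∧
      Ideal.ofList rs = maximalIdeal R := by
  obtain ⟨s, hs, hspan⟩ := Submodule.FG.exists_span_finset_card_eq_spanFinrank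
    (IsNoetherian.noetherian (maximalIdeal R))
  exact (isDomain_and_exists_isRegular _ R
    (IsRegularLocalRing.spanFinrank_maximalIdeal (R := R)).le s hs.le hspan).2

end RegularLocal

/-! ### Socles of quotients by regular sequences -/

section Socle

open scoped Pointwise

variable {R : Type u} [CommRing R] {X Z : Type u} [AddCommGroup X] [Module R X] [AddCommGroup Z]
  [Module R Z]

lemma extClass_postcomp_bijective {S : ShortComplex (ModuleCat.{u} R)} (hS : S.ShortExact)
    (Z : ModuleCat.{u} R) {i : ℕ} (h₂ : Subsingleton (Abelian.Ext Z S.X₂ i))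
    (hf : ∀ a : Abelian.Ext Z S.X₁ (i + 1), a.comp (Abelian.Ext.mk₀ S.f) (add_zero _) = 0) :
    Function.Bijective (hS.extClass.postcompOfLinear R Z (rfl : i + 1 = i + 1)) := by
  refine ⟨(injective_iff_map_eq_zero _).mpr fun a ha => ?_, fun b => ?_⟩
  · obtain ⟨c, rfl⟩ := Abelian.Ext.covariant_sequence_exact₃ Z hS a rfl ha
    rw [h₂.elim c 0, Abelian.Ext.zero_comp]
  · exact Abelian.Ext.covariant_sequence_exact₁ Z hS b (hf b) rfl

lemma ext_smul_eq_zero {X Z : ModuleCat.{u} R} {x : R} (hx : ∀ z : Z, x • z = 0) {i : ℕ}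
    (a : Abelian.Ext Z X i) : x • a = 0 := by
  have h : x • 𝟙 Z = 0 := by ext z; exact hx z
  rw [← ext_eq_smul_of_smul_id, h, Abelian.Ext.mk₀_zero, Abelian.Ext.zero_comp]

/-- Since x kills Z, it acts as zero on Ext from Z; with `Ext^i(Z, X) = 0` the connecting map of `0
→ X → X → X/xX → 0` is bijective. -/
lemma nonempty_ext_quotSMulTop_linearEquiv {x : R} (hx : ∀ z : Z, x • z = 0)
    (hreg : IsSMulRegular X x) {i : ℕ} (h : ExtVanishes R Z X i) :
    Nonempty (Abelian.Ext (ModuleCat.of R Z) (ModuleCat.of R (QuotSMulTop x X)) i ≃ₗ[R]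
      Abelian.Ext (ModuleCat.of R Z) (ModuleCat.of R X) (i + 1)) :=
  ⟨LinearEquiv.ofBijective _ (extClass_postcomp_bijective
    (IsSMulRegular.smulShortComplex_shortExact (M := ModuleCat.of R X) hreg) (ModuleCat.of R Z) h
    fun a => (Abelian.Ext.smul_eq_comp_mk₀ a x).symm.trans (ext_smul_eq_zero hx a))⟩

variable [IsLocalRing R]

lemma smul_residueField_eq_zero {x : R} (hx : x ∈ maximalIdeal R) (z : ResidueField R) :
    x • z = 0 := by
  rw [Algebra.smul_def]
  simp [hx]

lemma DepthGE.of_quotSMulTop {x : R} (hx : x ∈ maximalIdeal R) (hreg : IsSMulRegular X x) {n : ℕ}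
    (h : DepthGE R n (QuotSMulTop x X)) : DepthGE R (n + 1) X := by
  intro i hi
  induction i with
  | zero =>
    refine extVanishes_zero_iff.mpr
      (IsSMulRegular.linearMap_subsingleton_of_mem_annihilator hreg ?_)
    exact Module.mem_annihilator.mpr (smul_residueField_eq_zero hx)
  | succ i ih =>
    obtain ⟨e⟩ := nonempty_ext_quotSMulTop_linearEquiv (smul_residueField_eq_zero hx) hreg
      (ih (by omega))
    exact e.toEquiv.subsingleton_congr.mp (h i (by omega))

/-- Iterated degree shifting. The right-hand side depends on the sequence only through its length,
which permits comparing socles of different quotients. -/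
lemma depthGE_and_nonempty_linearEquiv_ext (rs : List R) (hrs : ∀ r ∈ rs, r ∈ maximalIdeal R)
    (hreg : RingTheory.Sequence.IsWeaklyRegular X rs) :
    DepthGE R rs.length X ∧
      Nonempty ((ResidueField R →ₗ[R] X ⧸ (Ideal.ofList rs • ⊤ : Submodule R X)) ≃ₗ[R]
        Abelian.Ext (ModuleCat.of R (ResidueField R)) (ModuleCat.of R X) rs.length) := by
  induction rs generalizing X with
  | nil =>
    refine ⟨depthGE_zero, ⟨?_⟩⟩
    have e : Abelian.Ext (ModuleCat.of R (ResidueField R)) (ModuleCat.of R X) 0 ≃ₗ[R]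
        (ResidueField R →ₗ[R] X) :=
      (Abelian.Ext.linearEquiv₀ (R := R)).trans (ModuleCat.homLinearEquiv (S := R))
    exact (LinearEquiv.congrRight (R := R) (M := ResidueField R)
      (Submodule.quotEquivOfEqBot (Ideal.ofList [] • ⊤ : Submodule R X) (by simp))).trans e.symm
  | cons x rs ih =>
    rw [RingTheory.Sequence.isWeaklyRegular_cons_iff] at hreg
    obtain ⟨h1, ⟨e1⟩⟩ := ih (fun r hr => hrs r (List.mem_cons_of_mem _ hr)) hreg.2
    have hx := hrs x List.mem_cons_self
    have h2 := h1.of_quotSMulTop hx hreg.1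
    obtain ⟨e2⟩ := nonempty_ext_quotSMulTop_linearEquiv (smul_residueField_eq_zero hx) hreg.1
      (h2 rs.length (by omega))
    exact ⟨h2, ⟨(LinearEquiv.congrRight
      (Submodule.quotOfListConsSMulTopEquivQuotSMulTopInner X x rs)).trans (e1.trans e2)⟩⟩

/-- The socle of the quotient of a regular local ring by a regular sequence is cyclic, if it is
nonzero. -/
theorem IsRegularLocalRing.linearMap_residueField_cyclic (Q : Type u) [CommRing Q]
    [IsRegularLocalRing Q] {rs : List Q} (hreg : RingTheory.Sequence.IsRegular Q rs)
    (hne : Nontrivial (ResidueField Q →ₗ[Q] Q ⧸ Ideal.ofList rs)) :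
    ∃ f : ResidueField Q →ₗ[Q] Q ⧸ Ideal.ofList rs, ∀ g, ∃ c : Q, g = c • f := by
  obtain ⟨ts, hts, htm⟩ := IsRegularLocalRing.exists_isRegular_ofList_eq Q
  have hrs : ∀ r ∈ rs, r ∈ maximalIdeal Q := fun r hr =>
    IsLocalRing.le_maximalIdeal (J := Ideal.ofList rs)
      (fun h => hreg.top_ne_smul (by rw [h]; simp)) (Ideal.subset_span hr)
  obtain ⟨hd1, ⟨e1⟩⟩ := depthGE_and_nonempty_linearEquiv_ext rs hrs hreg.1
  obtain ⟨hd2, ⟨e2⟩⟩ := depthGE_and_nonempty_linearEquiv_ext ts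
    (fun r hr => htm ▸ Ideal.subset_span hr) hts.1
  have e1' := (LinearEquiv.congrRight (R := Q) (M := ResidueField Q)
    (Submodule.quotEquivOfEq (Ideal.ofList rs) (Ideal.ofList rs • ⊤ : Ideal Q) (by simp))).trans e1
  have e2' := (LinearEquiv.congrRight (R := Q) (M := ResidueField Q)
    (Submodule.quotEquivOfEq (maximalIdeal Q) (Ideal.ofList ts • ⊤ : Ideal Q)
      (by simp [htm]))).trans e2
  -- Both lengths are the first degree in which Ext from the residue field to Q is nonzero.
  have hlen : rs.length = ts.length := by
    rcases lt_trichotomy rs.length ts.length with h | h | h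
    · have := hd2 _ h
      exact absurd hne (not_nontrivial_iff_subsingleton.mpr e1'.toEquiv.subsingleton)
    · exact h
    · have := hd1 _ h
      have h3 : Subsingleton (ResidueField Q →ₗ[Q] ResidueField Q) := e2'.toEquiv.subsingleton
      have h4 : (LinearMap.id : ResidueField Q →ₗ[Q] ResidueField Q) 1 = 0 := by
        rw [Subsingleton.elim (LinearMap.id : ResidueField Q →ₗ[Q] ResidueField Q) 0]; rfl
      exact absurd h4 one_ne_zero
  rw [← hlen] at e2'
  -- Both sides are the same Ext module, and endomorphisms of the residue field are generated by the
  -- identity.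
  let e : (ResidueField Q →ₗ[Q] ResidueField Q) ≃ₗ[Q] (ResidueField Q →ₗ[Q] Q ⧸ Ideal.ofList rs) :=
    e2'.trans e1'.symm
  refine ⟨e LinearMap.id, fun g => ?_⟩
  obtain ⟨c, hc⟩ := Ideal.Quotient.mk_surjective (I := maximalIdeal Q) (e.symm g 1)
  refine ⟨c, ?_⟩
  rw [← map_smul, ← LinearEquiv.symm_apply_eq]
  ext z
  obtain ⟨z, rfl⟩ := Ideal.Quotient.mk_surjective z
  have h5 : (Ideal.Quotient.mk (maximalIdeal Q) z : ResidueField Q) = z • (1 : ResidueField Q) := by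
    rw [Algebra.smul_def, mul_one]; rfl
  have h6 : e.symm g 1 = c • (1 : ResidueField Q) := by
    rw [Algebra.smul_def, mul_one]; exact hc.symm
  rw [h5, map_smul, h6, LinearMap.smul_apply, LinearMap.id_apply, smul_comm]

end Socle


/-! ### Complete intersections modulo a parameter have simple socle -/

section SimpleSocle

/-- The elements of `B` annihilated by all nonunits form a cyclic module without nonzero proper
submodules, or are all zero. -/
def HasSimpleSocle (B : Type*) [CommRing B] : Prop :=
  ∀ u v : B, u ≠ 0 → (∀ r, ¬ IsUnit r → r * u = 0) → (∀ r, ¬ IsUnit r → r * v = 0) → u ∣ v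

lemma HasSimpleSocle.of_ringEquiv {B C : Type*} [CommRing B] [CommRing C] (h : HasSimpleSocle B)
    (e : B ≃+* C) : HasSimpleSocle C := by
  intro u v hu hu' hv'
  have key : ∀ w : C, (∀ r, ¬ IsUnit r → r * w = 0) → ∀ r, ¬ IsUnit r → r * e.symm w = 0 := by
    intro w hw r hr
    have := hw (e r) (by rwa [MulEquiv.isUnit_map])
    rw [← e.symm.injective.eq_iff, map_mul, e.symm_apply_apply, map_zero] at this
    exact this
  have := h (e.symm u) (e.symm v) (by simpa using hu) (key u hu') (key v hv')
  simpa using map_dvd e this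

/-- Elements killed by all nonunits are values at 1 of maps from the residue field, and those maps
form a cyclic module. -/
lemma IsRegularLocalRing.hasSimpleSocle_quotient_ofList (Q : Type u) [CommRing Q]
    [IsRegularLocalRing Q] {rs : List Q} (hreg : RingTheory.Sequence.IsRegular Q rs) :
    HasSimpleSocle (Q ⧸ Ideal.ofList rs) := by
  intro u v hu hu' hv'
  have hne : Ideal.ofList rs ≠ ⊤ := fun h => hreg.top_ne_smul (by rw [h]; simp)
  have : Nontrivial (Q ⧸ Ideal.ofList rs) := Ideal.Quotient.nontrivial_iff.mpr hne
  have hex : ∀ w : Q ⧸ Ideal.ofList rs, (∀ r, ¬ IsUnit r → r * w = 0) →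
      ∃ f : ResidueField Q →ₗ[Q] Q ⧸ Ideal.ofList rs, f 1 = w := by
    intro w hw
    refine ⟨Submodule.liftQ (maximalIdeal Q) (LinearMap.toSpanSingleton Q _ w) ?_, ?_⟩
    · intro r hr
      rw [LinearMap.mem_ker, LinearMap.toSpanSingleton_apply, Algebra.smul_def]
      refine hw _ fun hun => ?_
      refine hne ((Ideal.eq_top_iff_one _).mpr ?_)
      obtain ⟨b, hb⟩ := hun.exists_right_inv
      obtain ⟨b, rfl⟩ := Ideal.Quotient.mk_surjective b
      rw [Ideal.Quotient.algebraMap_eq, ← map_mul, ← map_one (Ideal.Quotient.mk _),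
        Ideal.Quotient.eq] at hb
      have hrb : r * b - 1 ∈ maximalIdeal Q := le_maximalIdeal hne hb
      have : (1 : Q) ∈ maximalIdeal Q := by
        rw [← sub_sub_cancel (r * b) 1]
        exact Ideal.sub_mem _ (Ideal.mul_mem_right b _ hr) hrb
      exact absurd ((Ideal.eq_top_iff_one _).mpr this) (Ideal.IsPrime.ne_top inferInstance)
    · change Submodule.liftQ (maximalIdeal Q) _ _ (Submodule.Quotient.mk (1 : Q)) = w
      rw [Submodule.liftQ_apply]; simp
  obtain ⟨fu, hfu⟩ := hex u hu'
  obtain ⟨fv, hfv⟩ := hex v hv'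
  have hnt : Nontrivial (ResidueField Q →ₗ[Q] Q ⧸ Ideal.ofList rs) := by
    refine ⟨⟨fu, 0, fun h => hu ?_⟩⟩
    rw [← hfu, h]; rfl
  obtain ⟨f, hf⟩ := IsRegularLocalRing.linearMap_residueField_cyclic Q hreg hnt
  obtain ⟨a, ha⟩ := hf fu
  obtain ⟨b, hb⟩ := hf fv
  have haun : IsUnit a := by
    by_contra hcon
    refine hu ?_
    rw [← hfu, ha, LinearMap.smul_apply, ← map_smul,
      smul_residueField_eq_zero ((mem_maximalIdeal _).mpr hcon), map_zero]
  obtain ⟨c, hc⟩ := haun.exists_right_inv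
  refine ⟨algebraMap Q _ (b * c), ?_⟩
  rw [mul_comm, ← Algebra.smul_def, ← hfu, ← hfv, ha, hb, LinearMap.smul_apply,
    LinearMap.smul_apply, smul_smul]
  congr 1
  linear_combination -b * hc

variable {A : Type u} [CommRing A] [IsNoetherianRing A] [IsLocalRing A]

/-- The ideal `(x)` contains a power of 𝔪, so everything is visible modulo that power, where A and
its completion agree. -/
lemma nonempty_quotient_span_adicCompletion_ringEquiv {x : A} {n : ℕ}
    (hn : maximalIdeal A ^ n ≤ Ideal.span {x}) :
    Nonempty ((A ⧸ Ideal.span {x}) ≃+* (AdicCompletion (maximalIdeal A) A ⧸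
      Ideal.span {algebraMap A (AdicCompletion (maximalIdeal A) A) x})) := by
  set Ahat := AdicCompletion (maximalIdeal A) A
  let f : A →+* Ahat ⧸ Ideal.span {algebraMap A Ahat x} :=
    (Ideal.Quotient.mk _).comp (algebraMap A Ahat)
  have hker : RingHom.ker f = Ideal.span {x} := by
    ext a
    rw [RingHom.mem_ker, RingHom.comp_apply, Ideal.Quotient.eq_zero_iff_mem,
      Ideal.mem_span_singleton']
    constructor
    · rintro ⟨z, hz⟩
      have h1 := congrArg (AdicCompletion.evalₐ (maximalIdeal A) n) hz
      obtain ⟨b, hb⟩ := Ideal.Quotient.mk_surjective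
        (AdicCompletion.evalₐ (maximalIdeal A) n z)
      rw [map_mul, AlgHom.commutes, AlgHom.commutes, ← hb, Ideal.Quotient.algebraMap_eq, ← map_mul,
        eq_comm, Ideal.Quotient.eq] at h1
      have := Ideal.add_mem _ (hn h1) (Ideal.mul_mem_left _ b (Ideal.mem_span_singleton_self x))
      simpa using this
    · intro ha
      obtain ⟨b, rfl⟩ := Ideal.mem_span_singleton'.mp ha
      exact ⟨algebraMap A Ahat b, by rw [map_mul]⟩
  have hsurj : Function.Surjective f := by
    intro z
    obtain ⟨z, rfl⟩ := Ideal.Quotient.mk_surjective z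
    obtain ⟨a, ha⟩ := Submodule.Quotient.mk_surjective _
      (AdicCompletion.eval (maximalIdeal A) A n z)
    refine ⟨a, ?_⟩
    rw [RingHom.comp_apply, eq_comm, Ideal.Quotient.eq]
    have h1 : z - algebraMap A Ahat a ∈
        (AdicCompletion.eval (maximalIdeal A) A n).ker := by
      rw [LinearMap.mem_ker, map_sub, ← ha, sub_eq_zero]
      rfl
    rw [← AdicCompletion.pow_smul_top_eq_ker_eval (IsNoetherian.noetherian _)] at h1
    refine Submodule.smul_induction_on h1 (fun r hr y _ => ?_)
      fun y z hy hz => Ideal.add_mem _ hy hz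
    obtain ⟨b, rfl⟩ := Ideal.mem_span_singleton'.mp (hn hr)
    rw [Algebra.smul_def, map_mul]
    exact Ideal.mul_mem_right _ _ (Ideal.mul_mem_left _ _ (Ideal.mem_span_singleton_self _))
  exact ⟨(Ideal.quotEquivOfEq hker.symm).trans (RingHom.quotientKerEquivOfSurjective hsurj)⟩

/-- A zero-dimensional quotient of a complete intersection by a nonzerodivisor has simple socle. -/
theorem IsCompleteIntersectionLocal.hasSimpleSocle_quotient_span
    (h : IsCompleteIntersectionLocal A) {x : A} (hxm : x ∈ maximalIdeal A)
    (hx : x ∈ nonZeroDivisors A) {n : ℕ} (hn : maximalIdeal A ^ n ≤ Ideal.span {x}) :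
    HasSimpleSocle (A ⧸ Ideal.span {x}) := by
  obtain ⟨Q, _, _, rs, hreg, ⟨e⟩⟩ := h
  obtain ⟨e₁⟩ := nonempty_quotient_span_adicCompletion_ringEquiv hn
  set Ahat := AdicCompletion (maximalIdeal A) A
  let φ : Q →+* Ahat := e.toRingHom.comp (Ideal.Quotient.mk _)
  have hφ : Function.Surjective φ := e.surjective.comp Ideal.Quotient.mk_surjective
  have hφ0 : ∀ q, φ q = 0 ↔ q ∈ Ideal.ofList rs := by
    intro q
    rw [← Ideal.Quotient.eq_zero_iff_mem]
    exact e.map_eq_zero_iff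
  obtain ⟨y, hy⟩ := hφ (algebraMap A Ahat x)
  have hle : ∀ q, φ q = 0 → q ∈ Ideal.ofList (rs ++ [y]) := fun q hq => by
    rw [Ideal.ofList_append]
    exact Ideal.mem_sup_left ((hφ0 q).mp hq)
  have hker : RingHom.ker ((Ideal.Quotient.mk (Ideal.span {algebraMap A Ahat x})).comp φ) =
      Ideal.ofList (rs ++ [y]) := by
    ext q
    rw [RingHom.mem_ker, RingHom.comp_apply, Ideal.Quotient.eq_zero_iff_mem, ← hy]
    constructor
    · intro hq
      obtain ⟨z, hz⟩ := Ideal.mem_span_singleton'.mp hq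
      obtain ⟨z, rfl⟩ := hφ z
      have h1 := hle (q - z * y) (by rw [map_sub, map_mul, hz, sub_self])
      have h2 : y ∈ Ideal.ofList (rs ++ [y]) := Ideal.subset_span (by simp)
      have := Ideal.add_mem _ h1 (Ideal.mul_mem_left _ z h2)
      simpa using this
    · intro hq
      rw [Ideal.ofList_append, Ideal.ofList_singleton] at hq
      obtain ⟨a, ha, b, hb, rfl⟩ := Submodule.mem_sup.mp hq
      obtain ⟨c, rfl⟩ := Ideal.mem_span_singleton'.mp hb
      rw [map_add, (hφ0 a).mpr ha, zero_add, map_mul]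
      exact Ideal.mul_mem_left _ _ (Ideal.mem_span_singleton_self _)
  let e₂ : (Q ⧸ Ideal.ofList (rs ++ [y])) ≃+* (A ⧸ Ideal.span {x}) :=
    ((Ideal.quotEquivOfEq hker.symm).trans (RingHom.quotientKerEquivOfSurjective
      (Ideal.Quotient.mk_surjective.comp hφ))).trans e₁.symm
  have hne : Ideal.span {x} ≠ ⊤ := fun h => by
    have : Ideal.span {x} ≤ maximalIdeal A := (Ideal.span_singleton_le_iff_mem _).mpr hxm
    rw [h, top_le_iff] at this
    exact Ideal.IsPrime.ne_top inferInstance this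
  have hnt : Nontrivial (A ⧸ Ideal.span {x}) := Ideal.Quotient.nontrivial_iff.mpr hne
  -- Flatness of the completion keeps x regular, so a lift y of x to Q prolongs the sequence `rs`.
  have hxreg : IsSMulRegular Ahat x := Module.Flat.isSMulRegular_of_nonZeroDivisors hx
  refine (IsRegularLocalRing.hasSimpleSocle_quotient_ofList Q (rs := rs ++ [y])
    ⟨?_, ?_⟩).of_ringEquiv e₂
  · rw [RingTheory.Sequence.isWeaklyRegular_append_iff,
      RingTheory.Sequence.isWeaklyRegular_singleton_iff]
    refine ⟨hreg.1, ?_⟩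
    rw [isSMulRegular_iff_right_eq_zero_of_smul]
    intro m hm
    obtain ⟨q, rfl⟩ := Submodule.Quotient.mk_surjective _ m
    rw [← Submodule.Quotient.mk_smul, Submodule.Quotient.mk_eq_zero, smul_eq_mul, Ideal.mul_top,
      ← hφ0, smul_eq_mul, map_mul, hy,
      ← Algebra.smul_def] at hm
    rw [Submodule.Quotient.mk_eq_zero, smul_eq_mul, Ideal.mul_top, ← hφ0]
    exact isSMulRegular_iff_right_eq_zero_of_smul.mp hxreg _ hm
  · intro h
    rw [smul_eq_mul, Ideal.mul_top] at h
    exact Ideal.Quotient.nontrivial_iff.mp e₂.toEquiv.nontrivial h.symm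

end SimpleSocle

/-! ### Simple socle implies self-injectivity -/

section SelfInjective

lemma length_eq_add_length_range_of_exact {R X Y Z : Type*} [Ring R] [AddCommGroup X] [Module R X]
    [AddCommGroup Y] [Module R Y] [AddCommGroup Z] [Module R Z] (f : X →ₗ[R] Y) (g : Y →ₗ[R] Z)
    (hf : Function.Injective f) (h : Function.Exact f g) :
    Module.length R Y = Module.length R X + Module.length R (LinearMap.range g) := by
  refine Module.length_eq_add_of_exact f g.rangeRestrict hf
    (LinearMap.surjective_rangeRestrict g) fun y => ?_
  rw [← h y, ← (Submodule.subtype_injective _).eq_iff (a := g.rangeRestrict y)]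
  rfl

variable {B : Type u} [CommRing B] [IsLocalRing B] [IsArtinianRing B]

lemma HasSimpleSocle.length_linearMap_le_one (hB : HasSimpleSocle B) {L : Type u} [AddCommGroup L]
    [Module B L] {p : Ideal B} (hp : p.IsPrime) (e : L ≃ₗ[B] B ⧸ p) :
    Module.length B (L →ₗ[B] B) ≤ 1 := by
  have hpm : p = maximalIdeal B := eq_maximalIdeal inferInstance
  rcases subsingleton_or_nontrivial (L →ₗ[B] B) with h | h
  · rw [Module.length_eq_zero]; exact zero_le
  refine (Module.length_eq_one_iff.mpr
    (isSimpleModule_iff_toSpanSingleton_surjective.mpr ⟨h, fun f hf g => ?_⟩)).le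
  have hgen : ∀ f g : L →ₗ[B] B, f (e.symm 1) = g (e.symm 1) → f = g := by
    intro f g h
    ext z
    obtain ⟨z, rfl⟩ := e.symm.surjective z
    obtain ⟨z, rfl⟩ := Ideal.Quotient.mk_surjective z
    have : Ideal.Quotient.mk p z = z • (1 : B ⧸ p) := by
      rw [Algebra.smul_def, mul_one]; rfl
    rw [this, map_smul, map_smul, map_smul, h]
  have hsoc : ∀ f : L →ₗ[B] B, ∀ r : B, ¬ IsUnit r → r * f (e.symm 1) = 0 := by
    intro f r hr
    have h0 : r • (1 : B ⧸ p) = 0 := by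
      rw [Algebra.smul_def, mul_one, Ideal.Quotient.algebraMap_eq, Ideal.Quotient.eq_zero_iff_mem,
        hpm]
      exact (mem_maximalIdeal _).mpr hr
    rw [← smul_eq_mul, ← map_smul, ← map_smul, h0, map_zero, map_zero]
  obtain ⟨c, hc⟩ := hB (f (e.symm 1)) (g (e.symm 1)) (fun h0 => hf (hgen _ _ h0)) (hsoc f) (hsoc g)
  refine ⟨c, hgen _ _ ?_⟩
  rw [hc, LinearMap.toSpanSingleton_apply, LinearMap.smul_apply, smul_eq_mul, mul_comm]

/-- Dévissage: the dual is left exact, and simple modules have duals of length at most one. -/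
lemma HasSimpleSocle.length_linearMap_le (hB : HasSimpleSocle B) (L : Type u) [AddCommGroup L]
    [Module B L] [Module.Finite B L] : Module.length B (L →ₗ[B] B) ≤ Module.length B L := by
  induction ‹Module.Finite B L› using
    IsNoetherianRing.induction_on_isQuotientEquivQuotientPrime B with
  | subsingleton N => rw [Module.length_eq_zero (M := N →ₗ[B] B)]; exact zero_le
  | quotient N p e =>
    have : Nontrivial N :=
      have : Nontrivial (B ⧸ p.1) := Ideal.Quotient.nontrivial_iff.mpr p.2.ne_top
      e.toEquiv.nontrivial
    exact (hB.length_linearMap_le_one p.2 e).trans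
      (Order.one_le_iff_ne_zero.mpr (Module.length_pos (R := B) (M := N)).ne')
  | exact N₁ N₂ N₃ f g hf hg hfg h₁ h₃ =>
    rw [Module.length_eq_add_of_exact f g hf hg hfg, length_eq_add_length_range_of_exact
      (g.lcomp B B) (f.lcomp B B) (LinearMap.lcomp_injective_of_surjective g hg)
      (LinearMap.exact_lcomp_of_exact_of_surjective B hfg hg), add_comm]
    exact add_le_add ((Module.length_le_of_injective (LinearMap.range (f.lcomp B B)).subtype
      (Submodule.subtype_injective _)).trans h₁) h₃

/-- An Artinian local ring whose socle is simple is self-injective. -/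
theorem HasSimpleSocle.baer (hB : HasSimpleSocle B) : Module.Baer B B := by
  intro I g
  set f := I.subtype.lcomp B B
  suffices h : LinearMap.range f = ⊤ by
    obtain ⟨g', hg'⟩ := LinearMap.range_eq_top.mp h g
    exact ⟨g', fun x hx => congrArg (fun φ => φ ⟨x, hx⟩) hg'⟩
  -- Were restriction to I not surjective, the length of B would be strictly below `length I +
  -- length (B/I)`, which is the length of B.
  by_contra hcon
  have h1 := length_eq_add_length_range_of_exact (I.mkQ.lcomp B B) f
    (LinearMap.lcomp_injective_of_surjective I.mkQ I.mkQ_surjective)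
    (LinearMap.exact_lcomp_of_exact_of_surjective B (LinearMap.exact_subtype_mkQ I)
      I.mkQ_surjective)
  have h2 := Module.length_eq_add_of_exact I.subtype I.mkQ (Submodule.subtype_injective _)
    I.mkQ_surjective (LinearMap.exact_subtype_mkQ I)
  have h3 := hB.length_linearMap_le I
  have h4 := hB.length_linearMap_le (B ⧸ I)
  have h5 := Submodule.length_lt hcon
  rw [(LinearMap.ringLmapEquivSelf B B B).length_eq, h2] at h1
  have h6 : Module.length B (B ⧸ I) ≠ ⊤ := Module.length_ne_top
  have h8 := h5.trans_le h3
  have h9 := add_le_add_left h4 (Module.length B (LinearMap.range f))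
  rw [← h1] at h9
  rw [add_comm, ENat.add_le_add_iff_left h6] at h9
  exact absurd (h8.trans_le h9) (lt_irrefl _)

end SelfInjective


/-! ### Extending and lifting functionals modulo a regular element -/

section LiftModulo

open scoped Pointwise

variable {A : Type u} [CommRing A] {x : A}

/-- If `A ⧸ (x)` is self-injective, it is injective with respect to `A`-modules killed by `x`. -/
lemma Module.Baer.exists_comp_eq_of_smul_eq_zero
    (hB : Module.Baer (A ⧸ Ideal.span {x}) (A ⧸ Ideal.span {x})) {X Y : Type u} [AddCommGroup X]
    [Module A X] [AddCommGroup Y] [Module A Y] (hX : ∀ m : X, x • m = 0) (hY : ∀ m : Y, x • m = 0)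
    (j : X →ₗ[A] Y) (hj : Function.Injective j) (β : X →ₗ[A] A ⧸ Ideal.span {x}) :
    ∃ β' : Y →ₗ[A] A ⧸ Ideal.span {x}, β' ∘ₗ j = β := by
  have hX' : Module.IsTorsionBySet A X (Ideal.span {x}) :=
    (Module.isTorsionBySet_span_singleton_iff x).mpr fun m => hX m
  have hY' : Module.IsTorsionBySet A Y (Ideal.span {x}) :=
    (Module.isTorsionBySet_span_singleton_iff x).mpr fun m => hY m
  let := hX'.module
  let := hY'.module
  have hsurj : Function.Surjective (algebraMap A (A ⧸ Ideal.span {x})) :=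
    Ideal.Quotient.mk_surjective
  obtain ⟨h, hh⟩ := (Module.Baer.injective hB).out (j.extendScalarsOfSurjective hsurj) hj
    (β.extendScalarsOfSurjective hsurj)
  exact ⟨h.restrictScalars A, LinearMap.ext hh⟩

lemma exists_smul_eq_of_mk_comp_eq_zero (hx : IsSMulRegular A x) {X : Type*} [AddCommGroup X]
    [Module A X] (f : X →ₗ[A] A) (hf : ∀ m, Ideal.Quotient.mk (Ideal.span {x}) (f m) = 0) :
    ∃ g : X →ₗ[A] A, f = x • g := by
  let e := LinearEquiv.ofInjective (LinearMap.lsmul A A x) hx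
  have hr : ∀ m, f m ∈ LinearMap.range (LinearMap.lsmul A A x) := by
    intro m
    obtain ⟨c, hc⟩ := Ideal.mem_span_singleton'.mp (Ideal.Quotient.eq_zero_iff_mem.mp (hf m))
    exact ⟨c, by rw [← hc, LinearMap.lsmul_apply, smul_eq_mul, mul_comm]⟩
  refine ⟨e.symm.toLinearMap ∘ₗ f.codRestrict _ hr, LinearMap.ext fun m => ?_⟩
  have := congrArg Subtype.val (e.apply_symm_apply (f.codRestrict _ hr m))
  exact this.symm

variable [IsNoetherianRing A] [IsLocalRing A]

/-- Restriction of functionals from a free module to a submodule is surjective, if `x` is regular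
on the quotient and `A ⧸ (x)` is self-injective. -/
lemma exists_comp_subtype_eq_of_baer (hxm : x ∈ maximalIdeal A) (hx : IsSMulRegular A x)
    (hB : Module.Baer (A ⧸ Ideal.span {x}) (A ⧸ Ideal.span {x})) {F : Type u} [AddCommGroup F]
    [Module A F] [Module.Free A F] [Module.Finite A F] (K : Submodule A F)
    (hK : ∀ m : F, x • m ∈ K → m ∈ K) (g : K →ₗ[A] A) :
    ∃ g' : F →ₗ[A] A, g' ∘ₗ K.subtype = g := by
  set r : (F →ₗ[A] A) →ₗ[A] (K →ₗ[A] A) := K.subtype.lcomp A A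
  -- By Nakayama it suffices to extend functionals modulo x.
  have key : ∀ g : K →ₗ[A] A, ∃ (h : F →ₗ[A] A) (g' : K →ₗ[A] A), g = r h + x • g' := by
    intro g
    let j : QuotSMulTop x K →ₗ[A] QuotSMulTop x F :=
      Submodule.mapQ _ _ K.subtype (by
        rintro _ ⟨m, -, rfl⟩
        exact Submodule.smul_mem_pointwise_smul _ _ _ trivial)
    -- Saturation of K with respect to x is exactly what keeps `K/xK → F/xF` injective.
    have hj : Function.Injective j := by
      rw [← LinearMap.ker_eq_bot, LinearMap.ker_eq_bot']
      intro m hm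
      obtain ⟨m, rfl⟩ := Submodule.Quotient.mk_surjective _ m
      rw [Submodule.mapQ_apply, Submodule.Quotient.mk_eq_zero] at hm
      obtain ⟨y, -, hy⟩ := hm
      have hyK : y ∈ K := hK y (by
        have : x • y = m := hy
        rw [this]; exact m.2)
      rw [Submodule.Quotient.mk_eq_zero]
      exact ⟨⟨y, hyK⟩, trivial, Subtype.ext hy⟩
    have hkill : ∀ (Z : Type u) [AddCommGroup Z] [Module A Z] (m : QuotSMulTop x Z),
        x • m = 0 := by
      intro Z _ _ m
      obtain ⟨m, rfl⟩ := Submodule.Quotient.mk_surjective _ m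
      rw [← Submodule.Quotient.mk_smul, Submodule.Quotient.mk_eq_zero]
      exact Submodule.smul_mem_pointwise_smul _ _ _ trivial
    let p : A →ₗ[A] A ⧸ Ideal.span {x} := Submodule.mkQ _
    obtain ⟨β, hβ⟩ := hB.exists_comp_eq_of_smul_eq_zero (hkill K) (hkill F) j hj
      (Submodule.liftQ _ (p ∘ₗ g) (by
        rintro _ ⟨m, -, rfl⟩
        rw [LinearMap.mem_ker, DistribSMul.toLinearMap_apply, LinearMap.comp_apply, map_smul]
        exact Ideal.Quotient.eq_zero_iff_mem.mpr
          (Ideal.mul_mem_right _ _ (Ideal.mem_span_singleton_self x))))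
    obtain ⟨h, hh⟩ := Module.projective_lifting_property p (β ∘ₗ Submodule.mkQ _)
      (Submodule.mkQ_surjective _)
    obtain ⟨g', hg'⟩ := exists_smul_eq_of_mk_comp_eq_zero hx (g - r h) (by
      intro m
      have h1 := LinearMap.congr_fun hh m.1
      have h2 := LinearMap.congr_fun hβ (Submodule.Quotient.mk m)
      rw [LinearMap.sub_apply, map_sub, sub_eq_zero]
      exact h2.symm.trans h1.symm)
    exact ⟨h, g', by rw [← hg', add_sub_cancel]⟩
  have htop : (⊤ : Submodule A (K →ₗ[A] A)) ≤ LinearMap.range r := by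
    refine Submodule.le_of_le_smul_of_le_jacobson_bot (I := maximalIdeal A)
      (IsNoetherian.noetherian _) (maximalIdeal_le_jacobson _) ?_
    intro g _
    obtain ⟨h, g', rfl⟩ := key g
    exact Submodule.add_mem_sup ⟨h, rfl⟩ (Submodule.smul_mem_smul hxm trivial)
  exact htop trivial

/-- Maps to `A ⧸ (x)` lift to maps to `A`, if `x` is regular on the source and `A ⧸ (x)` is
self-injective. -/
lemma exists_mkQ_comp_eq_of_baer (hxm : x ∈ maximalIdeal A) (hx : IsSMulRegular A x)
    (hB : Module.Baer (A ⧸ Ideal.span {x}) (A ⧸ Ideal.span {x})) {N : Type u} [AddCommGroup N]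
    [Module A N] [Module.Finite A N] (hN : IsSMulRegular N x)
    (β : N →ₗ[A] A ⧸ Ideal.span {x}) :
    ∃ f : N →ₗ[A] A, Submodule.mkQ (Ideal.span {x}) ∘ₗ f = β := by
  obtain ⟨F, _, _, _, _, π, hπ⟩ := Module.exists_finite_presentation A N
  set K := LinearMap.ker π
  let p : A →ₗ[A] A ⧸ Ideal.span {x} := Submodule.mkQ _
  obtain ⟨h, hh⟩ := Module.projective_lifting_property p (β ∘ₗ π) (Submodule.mkQ_surjective _)
  -- The lift h of β on F is divisible by x on K. Extending the quotient g to F and subtracting x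
  -- times it leaves a functional that vanishes on K, with unchanged reduction.
  obtain ⟨g, hg⟩ := exists_smul_eq_of_mk_comp_eq_zero hx (h ∘ₗ K.subtype) (by
    intro m
    have h1 := LinearMap.congr_fun hh m.1
    have h2 : π m.1 = 0 := m.2
    rw [LinearMap.comp_apply, LinearMap.comp_apply, h2, map_zero] at h1
    exact h1)
  obtain ⟨g', rfl⟩ := exists_comp_subtype_eq_of_baer hxm hx hB K (by
    intro m hm
    rw [LinearMap.mem_ker, map_smul] at hm
    exact isSMulRegular_iff_right_eq_zero_of_smul.mp hN _ hm) g
  have hle : LinearMap.ker π ≤ LinearMap.ker (h - x • g') := by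
    intro m hm
    have := LinearMap.congr_fun hg ⟨m, hm⟩
    rw [LinearMap.mem_ker, LinearMap.sub_apply, sub_eq_zero]
    exact this
  refine ⟨(LinearMap.ker π).liftQ _ hle ∘ₗ (π.quotKerEquivOfSurjective hπ).symm.toLinearMap, ?_⟩
  ext m
  obtain ⟨m, rfl⟩ := hπ m
  have h1 : (π.quotKerEquivOfSurjective hπ).symm (π m) = Submodule.Quotient.mk m := by
    rw [LinearEquiv.symm_apply_eq]; rfl
  have h2 := LinearMap.congr_fun hh m
  rw [LinearMap.comp_apply, LinearMap.comp_apply, LinearEquiv.coe_coe, h1, Submodule.liftQ_apply,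
    LinearMap.sub_apply, map_sub]
  rw [LinearMap.comp_apply, LinearMap.comp_apply] at h2
  rw [show (Ideal.span {x}).mkQ (h m) = β (π m) from h2, sub_eq_self]
  exact Ideal.Quotient.eq_zero_iff_mem.mpr
    (Ideal.mul_mem_right _ _ (Ideal.mem_span_singleton_self x))

/-- Over a one-dimensional complete intersection, a submodule of a torsion-free module whose
functionals all extend is not properly contained in its saturation by the maximal ideal. -/
theorem IsCompleteIntersectionLocal.mem_of_forall_exists_comp_eq
    (hA : IsCompleteIntersectionLocal A) (hxm : x ∈ maximalIdeal A) (hx : IsSMulRegular A x)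
    (hmin : maximalIdeal A ∈ (Ideal.span {x}).minimalPrimes) {N' : Type u} [AddCommGroup N']
    [Module A N'] [Module.Finite A N'] (hN' : IsSMulRegular N' x) (N : Submodule A N')
    (hext : ∀ f : N →ₗ[A] A, ∃ f' : N' →ₗ[A] A, f' ∘ₗ N.subtype = f) {ξ : N'}
    (hξ : ∀ r ∈ maximalIdeal A, r • ξ ∈ N) : ξ ∈ N := by
  by_contra hcon
  have hart : IsArtinianRing (A ⧸ Ideal.span {x}) :=
    IsLocalRing.quotient_artinian_of_mem_minimalPrimes_of_isLocalRing _ hmin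
  have hnt : Nontrivial (A ⧸ Ideal.span {x}) := Ideal.Quotient.nontrivial_iff.mpr fun h => by
    rw [← top_le_iff] at h
    exact Ideal.IsPrime.ne_top (I := maximalIdeal A) inferInstance
      (top_le_iff.mp (h.trans ((Ideal.span_singleton_le_iff_mem _).mpr hxm)))
  have hloc : IsLocalRing (A ⧸ Ideal.span {x}) :=
    IsLocalRing.of_surjective' _ Ideal.Quotient.mk_surjective
  obtain ⟨n, hn⟩ : ∃ n, maximalIdeal A ^ n ≤ Ideal.span {x} := by
    have hrad : (Ideal.span {x}).radical = maximalIdeal A := by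
      rw [← Ideal.sInf_minimalPrimes]
      refine le_antisymm (sInf_le hmin) (le_sInf fun q hq => ?_)
      exact hmin.2 hq.1 (le_maximalIdeal hq.1.1.ne_top)
    obtain ⟨n, hn⟩ := Ideal.exists_radical_pow_le_of_fg (Ideal.span {x})
      (IsNoetherian.noetherian _)
    exact ⟨n, hrad ▸ hn⟩
  have hx0 : x ∈ nonZeroDivisors A := by
    rw [mem_nonZeroDivisors_iff_right]
    intro a ha
    exact isSMulRegular_iff_right_eq_zero_of_smul.mp hx a (by rwa [smul_eq_mul, mul_comm])
  have hB := (hA.hasSimpleSocle_quotient_span hxm hx0 hn).baer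
  obtain ⟨q, hq, -⟩ := exists_le_isAssociatedPrime_of_isNoetherianRing A
    (1 : A ⧸ Ideal.span {x}) one_ne_zero
  rw [isAssociatedPrime_iff] at hq
  obtain ⟨hqp, σ, hσ⟩ := hq
  have hqm : q = maximalIdeal A := by
    refine le_antisymm (le_maximalIdeal hqp.ne_top) (hmin.2 ⟨hqp, ?_⟩ (le_maximalIdeal hqp.ne_top))
    rw [Ideal.span_singleton_le_iff_mem, hσ, Submodule.mem_colon_singleton]
    obtain ⟨σ, rfl⟩ := Ideal.Quotient.mk_surjective σ
    exact Ideal.Quotient.eq_zero_iff_mem.mpr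
      (Ideal.mul_mem_right _ _ (Ideal.mem_span_singleton_self x))
  have hσm : ∀ r ∈ maximalIdeal A, r • σ = 0 := by
    intro r hr
    rw [← hqm, hσ, Submodule.mem_colon_singleton] at hr
    exact hr
  have hσ0 : σ ≠ 0 := by
    rintro rfl
    refine hqp.ne_top ((Ideal.eq_top_iff_one _).mpr ?_)
    rw [hσ, Submodule.mem_colon_singleton, smul_zero]
    exact zero_mem _
  -- If ξ is outside N, then xξ is a nonzero socle element of `N/xN`. Self-injectivity gives a map
  -- to `A/(x)` taking it to σ ≠ 0, which lifts to N. An extension f' would send xξ to x f'(ξ), zero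
  -- modulo x.
  let η : N := ⟨x • ξ, hξ x hxm⟩
  have hNreg : IsSMulRegular N x := hN'.of_injective N.subtype (Submodule.subtype_injective _)
  have hηm : ∀ r ∈ maximalIdeal A, r • (Submodule.Quotient.mk η : QuotSMulTop x N) = 0 := by
    intro r hr
    rw [← Submodule.Quotient.mk_smul, Submodule.Quotient.mk_eq_zero]
    exact ⟨⟨r • ξ, hξ r hr⟩, trivial, Subtype.ext (smul_comm x r ξ)⟩
  have hη0 : (Submodule.Quotient.mk η : QuotSMulTop x N) ≠ 0 := by
    rw [Ne, Submodule.Quotient.mk_eq_zero]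
    rintro ⟨m, -, hm⟩
    have h1 : x • (m : N') = x • ξ := congrArg Subtype.val hm
    exact hcon (hN' h1 ▸ m.2)
  let j : ResidueField A →ₗ[A] QuotSMulTop x N :=
    Submodule.liftQ (maximalIdeal A) (LinearMap.toSpanSingleton A _ (Submodule.Quotient.mk η)) hηm
  let s : ResidueField A →ₗ[A] A ⧸ Ideal.span {x} :=
    Submodule.liftQ (maximalIdeal A) (LinearMap.toSpanSingleton A _ σ) hσm
  have hj : Function.Injective j := by
    rw [← LinearMap.ker_eq_bot, LinearMap.ker_eq_bot']
    intro z hz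
    obtain ⟨z, rfl⟩ := Ideal.Quotient.mk_surjective (I := maximalIdeal A) z
    have hz' : z • (Submodule.Quotient.mk η : QuotSMulTop x N) = 0 := hz
    refine Ideal.Quotient.eq_zero_iff_mem.mpr ((mem_maximalIdeal _).mpr ?_)
    intro hun
    obtain ⟨b, hb⟩ := hun.exists_left_inv
    refine hη0 ?_
    rw [← one_smul A (Submodule.Quotient.mk η : QuotSMulTop x N), ← hb, mul_smul, hz', smul_zero]
  obtain ⟨β, hβ⟩ := hB.exists_comp_eq_of_smul_eq_zero (smul_residueField_eq_zero hxm)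
    (fun m => by
      obtain ⟨m, rfl⟩ := Submodule.Quotient.mk_surjective _ m
      rw [← Submodule.Quotient.mk_smul, Submodule.Quotient.mk_eq_zero]
      exact Submodule.smul_mem_pointwise_smul _ _ _ trivial) j hj s
  obtain ⟨f, hf⟩ := exists_mkQ_comp_eq_of_baer hxm hx hB hNreg (β ∘ₗ Submodule.mkQ _)
  obtain ⟨f', rfl⟩ := hext f
  have h1 := LinearMap.congr_fun hf η
  have h3 : j (Ideal.Quotient.mk (maximalIdeal A) 1) = Submodule.Quotient.mk η :=
    one_smul A (Submodule.Quotient.mk η : QuotSMulTop x N)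
  have h4 : s (Ideal.Quotient.mk (maximalIdeal A) 1) = σ := one_smul A σ
  have h2 : β (Submodule.Quotient.mk η) = σ := (congrArg β h3).symm.trans
    ((LinearMap.congr_fun hβ (Ideal.Quotient.mk (maximalIdeal A) 1)).trans h4)
  refine hσ0 ?_
  rw [← h2]
  refine h1.symm.trans ?_
  have h5 : (f' ∘ₗ N.subtype) η = x • f' ξ := map_smul f' x ξ
  rw [LinearMap.comp_apply, h5]
  exact Ideal.Quotient.eq_zero_iff_mem.mpr
    (Ideal.mul_mem_right _ _ (Ideal.mem_span_singleton_self x))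

end LiftModulo


/-! ### Associated primes of modules of maximal depth -/

section AssociatedPrimes

open scoped Pointwise

lemma ringKrullDim_quotient_add_one_le_of_lt {R : Type*} [CommRing R] {q p : Ideal R} [q.IsPrime]
    (h : q < p) : ringKrullDim (R ⧸ p) + 1 ≤ ringKrullDim (R ⧸ q) := by
  obtain ⟨hle, x, hxp, hxq⟩ := SetLike.lt_iff_le_and_exists.mp h
  exact ringKrullDim_succ_le_of_surjective (r := Ideal.Quotient.mk q x) (Ideal.Quotient.factor hle)
    (Ideal.Quotient.factor_surjective hle)
    (mem_nonZeroDivisors_of_ne_zero (by rwa [Ne, Ideal.Quotient.eq_zero_iff_mem]))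
    (by simpa [Ideal.Quotient.eq_zero_iff_mem] using hxp)

variable {R : Type u} [CommRing R] [IsNoetherianRing R]
  {X : Type u} [AddCommGroup X] [Module R X] [Module.Finite R X] {d : ℕ}

lemma exists_mem_isSMulRegular_of_forall_not_le {p : Ideal R}
    (h : ∀ q, IsAssociatedPrime q X → ¬ p ≤ q) : ∃ y ∈ p, IsSMulRegular X y := by
  by_contra! hcon
  have hsub : (p : Set R) ⊆ ⋃ I ∈ associatedPrimes R X, (I : Set R) := by
    rw [biUnion_associatedPrimes_eq_compl_regular]
    exact hcon
  obtain ⟨I, hI, hle⟩ := (Ideal.subset_union_prime_finite (associatedPrimes.finite R X)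
    (f := id) ⊥ ⊥ fun I hI _ _ => IsAssociatedPrime.isPrime hI).mp hsub
  exact h I hI hle

lemma exists_mem_forall_minimalPrimes_notMem {p : Ideal R} [p.IsPrime] (hp : p ∉ minimalPrimes R) :
    ∃ x ∈ p, ∀ q ∈ minimalPrimes R, x ∉ q := by
  by_contra! hcon
  have hsub : (p : Set R) ⊆ ⋃ I ∈ minimalPrimes R, (I : Set R) := fun x hx => by
    obtain ⟨q, hq, hxq⟩ := hcon x hx
    exact Set.mem_biUnion hq hxq
  obtain ⟨I, hI, hle⟩ := (Ideal.subset_union_prime_finite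
    (minimalPrimes.finite_of_isNoetherianRing R)
    (f := id) ⊥ ⊥ fun I hI _ _ => hI.1.1).mp hsub
  have : p = I := le_antisymm hle (hI.2 ⟨inferInstance, bot_le⟩ hle)
  exact hp (this ▸ hI)

variable [IsLocalRing R]

/-- An associated prime q has `dim R/q ≥ d`, which fails as soon as q strictly contains another
prime. -/
lemma DepthGE.mem_minimalPrimes (h : DepthGE R d X) (hd : ringKrullDim R = d) {q : Ideal R}
    (hq : IsAssociatedPrime q X) : q ∈ minimalPrimes R := by
  have hqp := hq.isPrime
  obtain ⟨q', hq', hle⟩ := Ideal.exists_minimalPrimes_le (bot_le : (⊥ : Ideal R) ≤ q)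
  rcases hle.eq_or_lt with rfl | hlt
  · exact hq'
  · have := hq'.1.1
    have h1 := ringKrullDim_quotient_add_one_le_of_lt hlt
    have h2 := h.le_ringKrullDim_quotient hq
    have h3 := ringKrullDim_quotient_le (R := R) q'
    rw [hd] at h3
    have h4 : ((d + 1 : ℕ) : WithBot ℕ∞) ≤ d := by
      push_cast
      exact (add_le_add_left h2 1).trans (h1.trans h3)
    have h5 : d + 1 ≤ d := by exact_mod_cast h4
    omega

lemma DepthGE.isSMulRegular (h : DepthGE R d X) (hd : ringKrullDim R = d) {x : R}
    (hx : ∀ q ∈ minimalPrimes R, x ∉ q) : IsSMulRegular X x := by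
  by_contra hcon
  have hmem : x ∈ ⋃ q ∈ associatedPrimes R X, (q : Set R) := by
    rw [biUnion_associatedPrimes_eq_compl_regular]
    exact hcon
  obtain ⟨q, hq, hxq⟩ := Set.mem_iUnion₂.mp hmem
  exact hx q (h.mem_minimalPrimes hd hq) hxq

/-- If some element of a module of depth `dim R` is not killed by any element outside a minimal
prime, it is zero. -/
lemma DepthGE.eq_zero (h : DepthGE R d X) (hd : ringKrullDim R = d) (m : X)
    (hm : ∀ q ∈ minimalPrimes R, ∃ s ∉ q, s • m = 0) : m = 0 := by
  by_contra hm0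
  obtain ⟨q, hq, hle⟩ := exists_le_isAssociatedPrime_of_isNoetherianRing R m hm0
  obtain ⟨s, hs, hsm⟩ := hm q (h.mem_minimalPrimes hd hq)
  exact hs (hle (by rw [Submodule.mem_colon_singleton, hsm]; exact zero_mem _))

end AssociatedPrimes

/-! ### Comparing a module with a generically equal submodule -/

section Saturation

open scoped Pointwise

/-- If `y` is regular modulo `x` on a submodule `N`, then `N` contains every element which is
multiplied into `N` by both `x` and `y`. -/
lemma mem_of_smul_mem_of_isSMulRegular {R X : Type*} [CommRing R] [AddCommGroup X] [Module R X]
    (N : Submodule R X) {x y : R} (hx : IsSMulRegular X x)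
    (hy : IsSMulRegular (QuotSMulTop x N) y) {ξ : X} (h₁ : x • ξ ∈ N) (h₂ : y • ξ ∈ N) : ξ ∈ N := by
  have h3 : (Submodule.Quotient.mk (⟨x • ξ, h₁⟩ : N) : QuotSMulTop x N) = 0 := by
    refine isSMulRegular_iff_right_eq_zero_of_smul.mp hy _ ?_
    rw [← Submodule.Quotient.mk_smul, Submodule.Quotient.mk_eq_zero]
    exact ⟨⟨y • ξ, h₂⟩, trivial, Subtype.ext (smul_comm x y ξ)⟩
  rw [Submodule.Quotient.mk_eq_zero] at h3
  obtain ⟨m, -, hm⟩ := h3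
  have h4 : x • (m : X) = x • ξ := congrArg Subtype.val hm
  exact hx h4 ▸ m.2

/-- If functionals on a finite submodule extend, they extend after localization. -/
lemma exists_comp_subtype_localized_eq {R : Type u} [CommRing R] [IsNoetherianRing R]
    (S : Submonoid R) {X : Type u} [AddCommGroup X] [Module R X] [Module.Finite R X]
    (N : Submodule R X) (hext : ∀ f : N →ₗ[R] R, ∃ f' : X →ₗ[R] R, f' ∘ₗ N.subtype = f)
    (g : N.localized S →ₗ[Localization S] Localization S) :
    ∃ g' : LocalizedModule S X →ₗ[Localization S] Localization S,
      g' ∘ₗ (N.localized S).subtype = g := by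
  have : Module.FinitePresentation R N := Module.finitePresentation_of_finite R N
  -- Clear denominators: s times the localized functional comes from a functional on N, which
  -- extends; then divide by s.
  obtain ⟨h, s, hs⟩ := Module.FinitePresentation.exists_lift_of_isLocalizedModule S
    (Algebra.linearMap R (Localization S)) (g.restrictScalars R ∘ₗ N.toLocalized S)
  obtain ⟨h', rfl⟩ := hext h
  let G := IsLocalizedModule.mapExtendScalars S (LocalizedModule.mkLinearMap S X)
    (Algebra.linearMap R (Localization S)) (Localization S) h'
  refine ⟨IsLocalization.mk' (Localization S) 1 s • G, ?_⟩
  apply LinearMap.restrictScalars_injective R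
  apply IsLocalizedModule.linearMap_ext S (N.toLocalized S) (Algebra.linearMap R (Localization S))
  ext m
  have h1 : G (LocalizedModule.mkLinearMap S X m) = algebraMap R (Localization S) (h' m) :=
    IsLocalizedModule.map_apply S (LocalizedModule.mkLinearMap S X)
      (Algebra.linearMap R (Localization S)) h' m
  have h2 : algebraMap R (Localization S) (h' m) = (s : R) • g (N.toLocalized S m) :=
    LinearMap.congr_fun hs m
  change IsLocalization.mk' (Localization S) 1 s • G (LocalizedModule.mkLinearMap S X m) =
    g (N.toLocalized S m)
  rw [h1, h2, smul_eq_mul, Algebra.smul_def, ← mul_assoc, mul_comm (IsLocalization.mk' _ _ _),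
    IsLocalization.mul_mk'_eq_mk'_of_mul, mul_one, IsLocalization.mk'_self', one_mul]

variable {R : Type u} [CommRing R] [IsNoetherianRing R] [IsLocalRing R]

/-- A finite module of depth `dim R` over a ring which is a complete intersection in codimension one
equals every submodule of depth `dim R` which generically coincides with it and whose functionals
all extend. -/
theorem IsCompleteIntersectionInCodimOne.eq_top_of_forall_exists_comp_eq
    (hci : IsCompleteIntersectionInCodimOne R) {d : ℕ} (hd : ringKrullDim R = d)
    (hR : DepthGE R d R) {X : Type u} [AddCommGroup X] [Module R X] [Module.Finite R X]
    (hX : DepthGE R d X) (N : Submodule R X) (hN : DepthGE R d N)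
    (hgen : ∀ q ∈ minimalPrimes R, ∀ ξ : X, ∃ s ∉ q, s • ξ ∈ N)
    (hext : ∀ f : N →ₗ[R] R, ∃ f' : X →ₗ[R] R, f' ∘ₗ N.subtype = f) : N = ⊤ := by
  by_contra hcon
  have hnt : Nontrivial (X ⧸ N) := Submodule.Quotient.nontrivial_iff.mpr hcon
  obtain ⟨c, hc⟩ := exists_ne (0 : X ⧸ N)
  obtain ⟨p, hp, -⟩ := exists_le_isAssociatedPrime_of_isNoetherianRing R c hc
  obtain ⟨hpp, c, hpc⟩ := isAssociatedPrime_iff.mp hp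
  obtain ⟨ξ, rfl⟩ := Submodule.Quotient.mk_surjective _ c
  have hmem : ∀ r, r ∈ p ↔ r • ξ ∈ N := by
    intro r
    rw [hpc, Submodule.mem_colon_singleton, Submodule.mem_bot, ← Submodule.Quotient.mk_smul,
      Submodule.Quotient.mk_eq_zero]
  have hξ : ξ ∉ N := fun h => hpp.ne_top
    ((Ideal.eq_top_iff_one _).mpr ((hmem 1).mpr (by rwa [one_smul])))
  have hpmin : p ∉ minimalPrimes R := fun h => by
    obtain ⟨s, hs, hsξ⟩ := hgen p h ξ
    exact hs ((hmem s).mpr hsξ)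
  obtain ⟨x, hxp, hx⟩ := exists_mem_forall_minimalPrimes_notMem hpmin
  have hxX := hX.isSMulRegular hd hx
  have hxN := hN.isSMulRegular hd hx
  have hxR := hR.isSMulRegular hd hx
  -- If p has height at least two, then `dim R/p ≤ d - 2`, whereas associated primes q of `N/xN`
  -- have `dim R/q ≥ d - 1`. So p contains an element y regular on `N/xN`, and x, y together force ξ
  -- into N.
  by_cases hchain : ∃ q₀ q₁ : Ideal R, q₀.IsPrime ∧ q₁.IsPrime ∧ q₀ < q₁ ∧ q₁ < p
  · obtain ⟨q₀, q₁, _, _, h01, h1p⟩ := hchain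
    have h1 := ringKrullDim_quotient_add_one_le_of_lt h01
    have h2 := ringKrullDim_quotient_add_one_le_of_lt h1p
    have h3 := ringKrullDim_quotient_le (R := R) q₀
    rw [hd] at h3
    obtain ⟨y, hyp, hy⟩ : ∃ y ∈ p, IsSMulRegular (QuotSMulTop x N) y := by
      refine exists_mem_isSMulRegular_of_forall_not_le fun q hq hpq => ?_
      rcases d with _ | d
      · have h4 : ringKrullDim (R ⧸ p) + 1 + 1 ≤ ((0 : ℕ) : WithBot ℕ∞) :=
          (add_le_add_left h2 1).trans (h1.trans h3)
        have h5 : (0 : WithBot ℕ∞) ≤ ringKrullDim (R ⧸ p) :=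
          have : Nontrivial (R ⧸ p) := Ideal.Quotient.nontrivial_iff.mpr hpp.ne_top
          ringKrullDim_nonneg_of_nontrivial
        have h6 : ((0 + 1 + 1 : ℕ) : WithBot ℕ∞) ≤ (0 : ℕ) := by
          push_cast
          exact (add_le_add_left (add_le_add_left h5 1) 1).trans h4
        have h7 : 0 + 1 + 1 ≤ 0 := by exact_mod_cast h6
        omega
      · have h4 := (hN.quotSMulTop hxN).le_ringKrullDim_quotient hq
        have h5 : ringKrullDim (R ⧸ q) ≤ ringKrullDim (R ⧸ p) :=
          ringKrullDim_le_of_surjective (Ideal.Quotient.factor hpq)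
            (Ideal.Quotient.factor_surjective hpq)
        have h6 : ((d + 1 + 1 : ℕ) : WithBot ℕ∞) ≤ (d + 1 : ℕ) := by
          push_cast
          push_cast at h3
          exact (add_le_add_left (add_le_add_left (h4.trans h5) 1) 1).trans
            ((add_le_add_left h2 1).trans (h1.trans h3))
        have h7 : d + 1 + 1 ≤ d + 1 := by exact_mod_cast h6
        omega
    exact hξ (mem_of_smul_mem_of_isSMulRegular N hxX hy ((hmem x).mp hxp) ((hmem y).mp hyp))
  -- Otherwise every prime strictly below p is minimal and avoids x, so the localization at p is a
  -- complete intersection whose maximal ideal is minimal over x.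
  · have hmin : ∀ q : Ideal R, q.IsPrime → q < p → q ∈ minimalPrimes R := by
      intro q hq hlt
      obtain ⟨q', hq', hle⟩ := Ideal.exists_minimalPrimes_le (bot_le : (⊥ : Ideal R) ≤ q)
      rcases hle.eq_or_lt with rfl | hlt'
      · exact hq'
      · exact absurd ⟨q', q, hq'.1.1, hq, hlt', hlt⟩ hchain
    have hht : p.height ≤ (1 : ℕ) := Ideal.height_le_iff.mpr fun q hq hlt => by
      rw [Ideal.height_eq_zero_iff.mpr (hmin q hq hlt)]
      exact zero_lt_one
    let A := Localization.AtPrime p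
    let ι := LocalizedModule.mkLinearMap p.primeCompl X
    have hmax : (maximalIdeal A) = p.map (algebraMap R A) :=
      (Localization.AtPrime.map_eq_maximalIdeal).symm
    have hmem' : ι ξ ∈ N.localized p.primeCompl := by
      refine (hci p hht).mem_of_forall_exists_comp_eq (x := algebraMap R A x)
        (by rw [hmax]; exact Ideal.mem_map_of_mem _ hxp)
        (hxR.of_isLocalization A p.primeCompl) ?_
        (hxX.of_isLocalizedModule A p.primeCompl ι) _
        (exists_comp_subtype_localized_eq p.primeCompl N hext) ?_
      · refine ⟨⟨inferInstance, (Ideal.span_singleton_le_iff_mem _).mpr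
          (by rw [hmax]; exact Ideal.mem_map_of_mem _ hxp)⟩, fun q ⟨hq, hxq⟩ hle => ?_⟩
        have hq' : (q.comap (algebraMap R A)).IsPrime := Ideal.comap_isPrime _ q
        have hle' : q.comap (algebraMap R A) ≤ p :=
          (Ideal.comap_mono hle).trans (Localization.AtPrime.under_maximalIdeal (I := p)).le
        rcases hle'.eq_or_lt with h | h
        · rw [hmax, Ideal.map_le_iff_le_comap, h]
        · exact absurd ((Ideal.span_singleton_le_iff_mem _).mp hxq) (hx _ (hmin _ hq' h))
      · have hle : maximalIdeal A ≤ (N.localized p.primeCompl).colon {ι ξ} := by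
          rw [hmax, Ideal.map_le_iff_le_comap]
          intro r hr
          rw [Ideal.mem_comap, Submodule.mem_colon_singleton, algebraMap_smul, ← map_smul]
          exact (N.toLocalized p.primeCompl ⟨r • ξ, (hmem r).mp hr⟩).2
        exact fun r hr => Submodule.mem_colon_singleton.mp (hle hr)
    obtain ⟨m, hm, s, hms⟩ := hmem'
    rw [IsLocalizedModule.mk'_eq_iff, Submonoid.smul_def, ← map_smul] at hms
    obtain ⟨t, ht⟩ := IsLocalizedModule.exists_of_eq (S := p.primeCompl) hms
    have h8 : ((t : R) * (s : R)) • ξ ∈ N := by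
      rw [mul_smul]
      have : (t : R) • m = (t : R) • (s : R) • ξ := ht
      rw [← this]
      exact N.smul_mem _ hm
    exact (t * s).2 ((hmem _).mpr h8)

end Saturation


/-! ### Generic freeness with denominators cleared -/

section ConstantRank

variable {R : Type u} [CommRing R] [IsNoetherianRing R] {M : Type u} [AddCommGroup M] [Module R M]
  [Module.Finite R M]

/-- At a minimal prime, a module of constant rank is a direct summand of a finite free module up to
an element outside of the prime. -/
lemma HasConstantRank.exists_comp_eq_smul_id (h : HasConstantRank R M) {q : Ideal R}
    (hq : q ∈ minimalPrimes R) : ∃ s ∉ q, ∃ (n : ℕ) (u : (Fin n → R) →ₗ[R] M)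
      (v : M →ₗ[R] (Fin n → R)), u ∘ₗ v = s • LinearMap.id := by
  obtain ⟨n, h⟩ := h
  have hqp : q.IsPrime := hq.1.1
  obtain ⟨e⟩ := h q hq
  let A := Localization.AtPrime q
  let S := q.primeCompl
  have : Module.FinitePresentation R M := Module.finitePresentation_of_finite R M
  let ι := LocalizedModule.mkLinearMap S M
  let κ : (Fin n → R) →ₗ[R] (Fin n → A) := LinearMap.pi fun i =>
    Algebra.linearMap R A ∘ₗ LinearMap.proj i
  -- The maps v and u are the local isomorphism and its inverse with denominators cleared; their
  -- composite is a scalar only after localization, whence the further factor t.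
  obtain ⟨v, s₁, hv⟩ := Module.FinitePresentation.exists_lift_of_isLocalizedModule S κ
    ((e.restrictScalars R).toLinearMap ∘ₗ ι)
  obtain ⟨u, s₂, hu⟩ := Module.FinitePresentation.exists_lift_of_isLocalizedModule S ι
    ((e.restrictScalars R).symm.toLinearMap ∘ₗ κ)
  have huv : ι ∘ₗ (u ∘ₗ v) = ι ∘ₗ (((s₂ : R) * (s₁ : R)) • LinearMap.id) := by
    ext m
    have h1 : ι (u (v m)) = (s₂ : R) • (e.restrictScalars R).symm (κ (v m)) :=
      LinearMap.congr_fun hu (v m)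
    have h2 : κ (v m) = (s₁ : R) • (e.restrictScalars R) (ι m) := LinearMap.congr_fun hv m
    rw [h2, map_smul, LinearEquiv.symm_apply_apply] at h1
    rw [LinearMap.comp_apply, LinearMap.comp_apply, h1, LinearMap.comp_apply,
      LinearMap.smul_apply, LinearMap.id_apply, map_smul, mul_smul]
  obtain ⟨t, ht⟩ := Module.Finite.exists_smul_of_comp_eq_of_isLocalizedModule S ι _ _ huv
  refine ⟨t * (s₂ * s₁), (t * (s₂ * s₁)).2, n, (t : R) • u, v, ?_⟩
  rw [LinearMap.smul_comp, mul_smul]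
  exact ht

end ConstantRank

/-! ### Dual bases up to a scalar -/

section Summand

variable {R : Type u} [CommRing R] {M : Type u} [AddCommGroup M] [Module R M] {s : R} {n : ℕ}
  {u : (Fin n → R) →ₗ[R] M} {v : M →ₗ[R] (Fin n → R)}

/-- The dual basis identity up to s: the coordinates of v and the images under u of the standard
basis form the dual pair. -/
lemma sum_smul_proj_comp_eq_smul (h : u ∘ₗ v = s • LinearMap.id) (φ : Module.Dual R M) :
    ∑ i, φ (u (Pi.single i 1)) • (LinearMap.proj i ∘ₗ v) = s • φ := by
  ext m
  have h1 : u (v m) = s • m := LinearMap.congr_fun h m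
  rw [LinearMap.smul_apply, ← map_smul, ← h1, pi_eq_sum_univ' (v m), map_sum, map_sum,
    LinearMap.sum_apply]
  refine Finset.sum_congr rfl fun i _ => ?_
  rw [map_smul, map_smul, LinearMap.smul_apply, smul_eq_mul, smul_eq_mul, mul_comm]
  rfl

lemma smul_eq_zero_of_dual_eval_eq_zero (h : u ∘ₗ v = s • LinearMap.id) {m : M}
    (hm : Module.Dual.eval R M m = 0) : s • m = 0 := by
  have h1 : u (v m) = s • m := LinearMap.congr_fun h m
  have h2 : v m = 0 := by
    ext i
    exact LinearMap.congr_fun hm (LinearMap.proj i ∘ₗ v)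
  rw [← h1, h2, map_zero]

lemma smul_mem_range_dual_eval (h : u ∘ₗ v = s • LinearMap.id)
    (ξ : Module.Dual R (Module.Dual R M)) : s • ξ ∈ LinearMap.range (Module.Dual.eval R M) := by
  refine ⟨∑ i, ξ (LinearMap.proj i ∘ₗ v) • u (Pi.single i 1), ?_⟩
  ext φ
  rw [LinearMap.smul_apply, ← map_smul, ← sum_smul_proj_comp_eq_smul h, map_sum, map_sum,
    LinearMap.sum_apply]
  refine Finset.sum_congr rfl fun i _ => ?_
  rw [map_smul, map_smul, LinearMap.smul_apply, Module.Dual.eval_apply, smul_eq_mul, smul_eq_mul,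
    mul_comm]

lemma exists_comp_dualTensorHom_eq_smul_id (h : u ∘ₗ v = s • LinearMap.id) :
    ∃ β : (M →ₗ[R] M) →ₗ[R] Module.Dual R M ⊗[R] M,
      β ∘ₗ dualTensorHom R M M = s • LinearMap.id := by
  -- The usual inverse for a projective module, up to s: an endomorphism g goes to the sum of `vᵢ ⊗
  -- g(u eᵢ)`.
  refine ⟨∑ i, TensorProduct.mk R _ _ (LinearMap.proj i ∘ₗ v) ∘ₗ
    LinearMap.applyₗ (u (Pi.single i 1)), TensorProduct.ext' fun φ m => ?_⟩
  rw [LinearMap.comp_apply, LinearMap.sum_apply, LinearMap.smul_apply, LinearMap.id_apply,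
    TensorProduct.smul_tmul', ← sum_smul_proj_comp_eq_smul h, TensorProduct.sum_tmul]
  refine Finset.sum_congr rfl fun i _ => ?_
  rw [LinearMap.comp_apply, LinearMap.applyₗ_apply_apply, dualTensorHom_apply,
    TensorProduct.mk_apply, TensorProduct.tmul_smul, TensorProduct.smul_tmul']

end Summand

/-! ### Reflexivity, injectivity and the theorem -/

section Main

variable {R : Type u} [CommRing R] [IsNoetherianRing R] [IsLocalRing R] {M : Type u}
  [AddCommGroup M] [Module R M] [Module.Finite R M] {d : ℕ}

theorem HasConstantRank.isReflexive (hrank : HasConstantRank R M) (hd : ringKrullDim R = d)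
    (hR : DepthGE R d R) (hci : IsCompleteIntersectionInCodimOne R) (hM : DepthGE R d M)
    (hMdual : ExtVanishesUpTo R d (Module.Dual R M) R) : Module.IsReflexive R M := by
  have hinj : Function.Injective (Module.Dual.eval R M) := by
    rw [← LinearMap.ker_eq_bot, LinearMap.ker_eq_bot']
    refine fun m hm => hM.eq_zero hd m fun q hq => ?_
    obtain ⟨s, hs, n, u, v, huv⟩ := hrank.exists_comp_eq_smul_id hq
    exact ⟨s, hs, smul_eq_zero_of_dual_eval_eq_zero huv hm⟩
  have hfin : Module.Finite R (Module.Dual R M) := inferInstanceAs (Module.Finite R (M →ₗ[R] R))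
  have hfin' : Module.Finite R (Module.Dual R (Module.Dual R M)) :=
    inferInstanceAs (Module.Finite R (Module.Dual R M →ₗ[R] R))
  let e := LinearEquiv.ofInjective (Module.Dual.eval R M) hinj
  refine ⟨hinj, LinearMap.range_eq_top.mp ?_⟩
  refine hci.eq_top_of_forall_exists_comp_eq hd hR (hR.linearMap hMdual) _ (hM.congr e)
    (fun q hq ξ => ?_) fun f => ?_
  · obtain ⟨s, hs, n, u, v, huv⟩ := hrank.exists_comp_eq_smul_id hq
    exact ⟨s, hs, smul_mem_range_dual_eval huv ξ⟩
  -- A functional on the copy of M inside `M**` is an element of `M*`; evaluation at that element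
  -- extends it.
  · refine ⟨Module.Dual.eval R _ (f ∘ₗ e.toLinearMap), LinearMap.ext fun y => ?_⟩
    obtain ⟨m, rfl⟩ := e.surjective y
    rfl

/-- At each minimal prime α has a left inverse up to a scalar s outside it, and this survives
tensoring with W. So s kills the kernel, which depth d then forces to vanish. -/
theorem HasConstantRank.lTensor_dualTensorHom_injective (hrank : HasConstantRank R M)
    (hd : ringKrullDim R = d) {W : Type u} [AddCommGroup W] [Module R W] [Module.Finite R W]
    (hW : DepthGE R d (W ⊗[R] (Module.Dual R M ⊗[R] M))) :
    Function.Injective (LinearMap.lTensor W (dualTensorHom R M M)) := by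
  have hfin : Module.Finite R (Module.Dual R M) := inferInstanceAs (Module.Finite R (M →ₗ[R] R))
  rw [← LinearMap.ker_eq_bot, LinearMap.ker_eq_bot']
  refine fun t ht => hW.eq_zero hd t fun q hq => ?_
  obtain ⟨s, hs, n, u, v, huv⟩ := hrank.exists_comp_eq_smul_id hq
  obtain ⟨β, hβ⟩ := exists_comp_dualTensorHom_eq_smul_id huv
  refine ⟨s, hs, ?_⟩
  have h1 := LinearMap.congr_fun (congrArg (LinearMap.lTensor W) hβ) t
  rw [LinearMap.lTensor_comp, LinearMap.comp_apply, ht, map_zero, LinearMap.lTensor_smul,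
    LinearMap.lTensor_id] at h1
  exact h1.symm

end Main

theorem mainTheorem4 (R : Type u) [CommRing R] [IsNoetherianRing R] [IsLocalRing R]
    (hR : IsCohenMacaulayLocal R) (d : ℕ) (hd : ringKrullDim R = d)
    (M : Type u) [AddCommGroup M] [Module R M] [Module.Finite R M]
    (hrank : HasConstantRank R M)
    (hMM : ExtVanishesUpTo R d M M)
    (hMdual : ExtVanishesUpTo R d (Module.Dual R M) R) :
    (∀ ω : Ideal R, IsCanonicalModule R ω → Module.IsReflexive R M →
      IsMaximalCohenMacaulay R (ω ⊗[R] (Module.Dual R M ⊗[R] M))) ∧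
    (IsAdicComplete (maximalIdeal R) R →
      IsCompleteIntersectionInCodimOne R →
      (IsGorensteinLocal R ∨ Nonempty (ℚ →+* R)) →
      IsMaximalCohenMacaulay R M →
      ExtVanishesUpTo R d M R →
      ∀ (ω : Type u) [AddCommGroup ω] [Module R ω], IsCanonicalModule R ω →
        IsMaximalCohenMacaulay R (ω ⊗[R] (Module.Dual R M ⊗[R] M)) ∧
        Function.Injective (LinearMap.lTensor ω (dualTensorHom R M M))) := by
  have hfin : Module.Finite R (Module.Dual R M) := inferInstanceAs (Module.Finite R (M →ₗ[R] R))
  have hRd := depthGE_of_isCohenMacaulayLocal hR hd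
  have key : ∀ (W : Type u) [AddCommGroup W] [Module R W], IsCanonicalModule R W →
      Module.IsReflexive R M → Module.Finite R W ∧
        DepthGE R d (W ⊗[R] (Module.Dual R M ⊗[R] M)) := by
    intro W _ _ hW hM
    obtain ⟨hWfin, hWd⟩ := (isMaximalCohenMacaulay_iff hd).mp hW.isMaximalCohenMacaulay
    exact ⟨hWfin,
      depthGE_tensor_dual_tensor hR hd hW.hasFiniteInjectiveDimension hWd hMM hMdual⟩
  constructor
  · intro ω hω hM
    obtain ⟨hωfin, hωd⟩ := key ω hω hM
    exact (isMaximalCohenMacaulay_iff hd).mpr ⟨inferInstance, hωd⟩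
  · intro _ hci _ hM _ ω _ _ hω
    have hM' := ((isMaximalCohenMacaulay_iff hd).mp hM).2
    have hrefl := hrank.isReflexive hd hRd hci hM' hMdual
    obtain ⟨hωfin, hωd⟩ := key ω hω hrefl
    exact ⟨(isMaximalCohenMacaulay_iff hd).mpr ⟨inferInstance, hωd⟩,
      hrank.lTensor_dualTensorHom_injective hd hωd⟩
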